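/- Let $S$ be a finite set of prime numbers (so $\infty\notin S$), let $d\ge 1$, $m\ge 0$ be integers and $n=d+m$. For a prime $\nu$ let $|\cdot|_\nu$ be the $\nu$-adic absolute value on $\mathbb{Q}_\nu$ with ring of integers $\mathbb{Z}_\nu$. Put $\mathbb{Z}_S^k=\prod_{\nu\in S}\mathbb{Z}_\nu^k\subset\mathbb{Q}_S^k=\prod_{\nu\in S}\mathbb{Q}_\nu^k$, and let $\mu_{S,d}$ be the Haar measure on $\mathbb{Q}_S^d$ with $\mu_{S,d}(\mathbb{Z}_S^d)=1$. For $\tilde{\mathbf b}=(b_0,\dots,b_n)\in\mathbb{Z}^{n+1}$ let $\|\tilde{\mathbf b}\|_\infty=\max_i|b_i|$. **Manifold.** For each $\nu\in S$ let $\mathcal{U}_\nu\subseteq\mathbb{Z}_\nu^d$ be open and let $\mathbf{f}_\nu:\mathcal{U}_\nu\to\mathbb{Z}_\nu^m$ be a $C^2$ map (in the ultrametric sense: the difference quotients of orders one and two extend to continuous functions; precisely, the function $(\mathbf{x},\mathbf{v},t)\mapsto t^{-1}(\mathbf{f}_\nu(\mathbf{x}+t\mathbf{v})-\mathbf{f}_\nu(\mathbf{x}))$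 extends continuously from $t\ne0$ to all $(\mathbf{x},\mathbf{v},t)\in\mathbb{Q}_\nu^d\times\mathbb{Q}_\nu^d\times\mathbb{Q}_\nu$ with $\mathbf{x},\mathbf{x}+t\mathbf{v}\in\mathcal{U}_\nu$, and the difference quotient of the extended function extends continuously in the same way). Let $\mathcal{U}=\prod_{\nu\in S}\mathcal{U}_\nu$, $\mathbf{F}(\mathbf{x})=(\mathbf{x}_\nu,\mathbf{f}_\nu(\mathbf{x}_\nu))_{\nu\in S}\in\mathbb{Z}_S^n$ for $\mathbf{x}\in\mathcal{U}$, and $\mathcal{M}=\mathbf{F}(\mathcal{U})$. **Weights.** Call a family $\boldsymbol\tau=(\tau_{i,\nu})_{1\le i\le n,\,\nu\in S}$ of positive real numbers *admissible* if $$\sum_{i=1}^n\sum_{\nu\in S}\tau_{i,\nu}=n+1\qquad\text{and}\qquad\sum_{\nu\in S}\tau_{i,\nu}>1\quad(1\le i\le n).$$ **Exponents.** For an admissible $\boldsymbol\tau$ and $\mathbf{y}\in\mathbb{Q}_S^n$ let $\omega_{\boldsymbol\tau}(\mathbf{y})\in[-\infty,\infty]$ be the supremum of all real $\omega$ such that $$\max_{i,\nu}|b_0y_{i,\nu}+b_i|_\nu^{1/\tau_{i,\nu}}\le\|\tilde{\mathbf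 b}\|_\infty^{-\omega}$$ for infinitely many $\tilde{\mathbf b}\in\mathbb{Z}^{n+1}$, and let $$\omega_{\boldsymbol\tau}(\mathcal{M})=\inf\{\omega\in[-\infty,\infty]:\ \omega_{\boldsymbol\tau}(\mathbf{F}(\mathbf{x}))\le\omega\ \text{ for } \mu_{S,d}\text{-almost every }\mathbf{x}\in\mathcal{U}\}.$$ The manifold $\mathcal{M}$ is *strongly extremal* if $\omega_{\boldsymbol\tau}(\mathcal{M})=1$ for every admissible $\boldsymbol\tau$. **Badly approximable points.** Let $\mathbf{Bad}^{(S)}_n(\boldsymbol\tau)$ be the set of all $\mathbf{y}\in\mathbb{Z}_S^n$ for which there is an integer $\ell\ge1$ such that only finitely many $\tilde{\mathbf b}\in\mathbb{Z}^{n+1}$ satisfy $$|b_0y_{i,\nu}-b_i|_\nu<\tfrac1\ell\,\|\tilde{\mathbf b}\|_\infty^{-\tau_{i,\nu}}\qquad(1\le i\le n,\ \nu\in S).$$ **Statement.** Let $\boldsymbol\tau$ be admissible and suppose that $$\min_{1\le i\le d}\tau_{i,\nu}\ \ge\ \max_{1\le j\le m}\tau_{d+j,\nu}\qquad\text{for all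 }\nu\in S$$ (no condition if $m=0$). If $\mathcal{M}$ is strongly extremal, then $$\mu_{S,d}\big(\mathbf{F}^{-1}(\mathbf{Bad}^{(S)}_n(\boldsymbol\tau))\big)=0.$$ -/

import Mathlib

open MeasureTheory Set Topology

/-! ### Difference-quotient calculus over a topological field -/

section DifferenceCalculus

variable {K E F : Type*} [Field K] [TopologicalSpace K]
  [AddCommGroup E] [Module K E] [TopologicalSpace E]
  [AddCommGroup F] [Module K F] [TopologicalSpace F]

/-- The set `U^[1]` of all triples `(x, v, t)` with `x ∈ U` and `x + t v ∈ U`. -/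
def diffDomain (K : Type*) {E : Type*} [Field K] [AddCommGroup E] [Module K E] (U : Set E) :
    Set (E × E × K) :=
  {z | z.1 ∈ U ∧ z.1 + z.2.2 • z.2.1 ∈ U}

/-- `g` is a continuous extension to all of `U^[1]` (including `t = 0`) of the difference quotient
`(x, v, t) ↦ (f (x + t v) - f x) / t`. Over a non-discrete field there is at most one such
function on `U^[1]` when `U` is open. -/
def IsDiffQuotient (f : E → F) (U : Set E) (g : E × E × K → F) : Prop :=
  ContinuousOn g (diffDomain K U) ∧
    ∀ z ∈ diffDomain K U, z.2.2 • g z = f (z.1 + z.2.2 • z.2.1) - f z.1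

/-- `f` is `C¹` on the open set `U` (strictly, in the sense of difference quotients). -/
def IsC1On (K : Type*) {E F : Type*} [Field K] [TopologicalSpace K]
    [AddCommGroup E] [Module K E] [TopologicalSpace E]
    [AddCommGroup F] [Module K F] [TopologicalSpace F] (f : E → F) (U : Set E) : Prop :=
  ∃ g : E × E × K → F, IsDiffQuotient f U g

/-- `f` is `C²` on the open set `U`: its difference quotient extends to a function on `U^[1]`
which is itself `C¹`. This is the ultrametric notion of a `C²` map (all difference quotients up to
order two extend continuously); over a non-archimedean field it is strictly stronger than twice
continuous Fréchet differentiability. -/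
def IsC2On (K : Type*) {E F : Type*} [Field K] [TopologicalSpace K]
    [AddCommGroup E] [Module K E] [TopologicalSpace E]
    [AddCommGroup F] [Module K F] [TopologicalSpace F] (f : E → F) (U : Set E) : Prop :=
  ∃ g : E × E × K → F, IsDiffQuotient f U g ∧ IsC1On K g (diffDomain K U)

end DifferenceCalculus

/-! ### The `S`-arithmetic space for a finite set `S` of primes -/

instance factPrimeOfPrimes (p : Nat.Primes) : Fact (p : ℕ).Prime := ⟨p.2⟩

/-- The completion of `ℚ` at the prime `p`. -/
abbrev Qv (p : Nat.Primes) : Type := ℚ_[(p : ℕ)]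

noncomputable instance measurableSpaceQv (p : Nat.Primes) : MeasurableSpace (Qv p) := borel _

instance borelSpaceQv (p : Nat.Primes) : BorelSpace (Qv p) := ⟨rfl⟩

/-- `ℤ_p ⊆ ℚ_p`, as a compact set with non-empty interior. -/
noncomputable def unitBall (p : Nat.Primes) : TopologicalSpace.PositiveCompacts (Qv p) where
  carrier := Metric.closedBall 0 1
  isCompact' := isCompact_closedBall 0 1
  interior_nonempty' :=
    ⟨0, Metric.ball_subset_interior_closedBall (Metric.mem_ball_self one_pos)⟩

/-- The Haar measure on `ℚ_p` normalised by `μ_p(ℤ_p) = 1`. -/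
noncomputable def haarQv (p : Nat.Primes) : Measure (Qv p) :=
  Measure.addHaarMeasure (unitBall p)

/-- `ℚ_S^k = ∏_{ν ∈ S} ℚ_ν^k`; the coordinate `x_{i,ν}` of `x` is `x ν i`. -/
abbrev QS (S : Finset Nat.Primes) (k : ℕ) : Type := (ν : S) → Fin k → Qv ν

/-- `ℤ_ν^k ⊆ ℚ_ν^k`. -/
def integralPoints (p : Nat.Primes) (k : ℕ) : Set (Fin k → Qv p) := {x | ∀ i, ‖x i‖ ≤ 1}

/-- The `S`-arithmetic Haar measure `μ_{S,k}` on `ℚ_S^k`, normalised by `μ_{S,k}(ℤ_S^k) = 1`: the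
product of the normalised Haar measures of the factors. -/
noncomputable def haarQS (S : Finset Nat.Primes) (k : ℕ) : Measure (QS S k) :=
  Measure.pi fun ν : S => Measure.pi fun _ : Fin k => haarQv ν

/-! ### Weights, exponents and badly approximable points -/

/-- Weights `τ = (τ_{i,ν})` (written `τ i ν`): positive reals of total sum `n + 1`, whose sum over
the places exceeds `1` for every coordinate. -/
structure IsWeight (S : Finset Nat.Primes) (n : ℕ) (τ : Fin n → S → ℝ) : Prop where
  pos : ∀ i ν, 0 < τ i ν
  sum_eq : ∑ i, ∑ ν, τ i ν = n + 1
  one_lt : ∀ i, 1 < ∑ ν, τ i ν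

/-- The Diophantine exponent `ω_τ(y)`: the supremum of all real `ω` such that
`max_{i,ν} |b₀ y_{i,ν} + b_i|_ν ^ (1 / τ_{i,ν}) ≤ ‖(b₀, …, b_n)‖_∞ ^ (-ω)` for infinitely many
`(b₀, …, b_n) ∈ ℤ^(n+1)`. The norm on `Fin (n + 1) → ℤ` is the sup norm. -/
noncomputable def exponentPoint (S : Finset Nat.Primes) (n : ℕ) (τ : Fin n → S → ℝ)
    (y : QS S n) : EReal :=
  sSup {w : EReal | ∃ ω : ℝ, w = ω ∧
    {b : Fin (n + 1) → ℤ | ∀ (i : Fin n) (ν : S),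
      ‖(b 0 : Qv ν) * y ν i + (b i.succ : Qv ν)‖ ^ (1 / τ i ν) ≤ ‖b‖ ^ (-ω)}.Infinite}

/-- The set `W(c, τ)` of all `y ∈ ℤ_S^n` such that `|b₀ y_{i,ν} - b_i|_ν < c ‖b‖_∞ ^ (-τ_{i,ν})`
for all `i`, `ν` has infinitely many solutions `b = (b₀, …, b_n) ∈ ℤ^(n+1)`. -/
def approxSet (S : Finset Nat.Primes) (n : ℕ) (c : ℝ) (τ : Fin n → S → ℝ) : Set (QS S n) :=
  {y | (∀ ν : S, y ν ∈ integralPoints ν n) ∧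
    {b : Fin (n + 1) → ℤ | ∀ (i : Fin n) (ν : S),
      ‖(b 0 : Qv ν) * y ν i - (b i.succ : Qv ν)‖ < c * ‖b‖ ^ (-τ i ν)}.Infinite}

/-- The set `Bad(τ) = ℤ_S^n \ ⋂_ℓ W(1/ℓ, τ)` of `τ`-badly approximable points of `ℤ_S^n`. It contains
`W(1, τ) \ ⋂_ℓ W(1/ℓ, τ)`. -/
def badSet (S : Finset Nat.Primes) (n : ℕ) (τ : Fin n → S → ℝ) : Set (QS S n) :=
  {y | ∀ ν : S, y ν ∈ integralPoints ν n} \ ⋂ ℓ : ℕ, approxSet S n (1 / ((ℓ : ℝ) + 1)) τ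

/-! ### `S`-arithmetic manifolds -/

/-- The parameterisation `F(x) = (x_ν, f_ν(x_ν))_{ν ∈ S}`. -/
def graphMap {S : Finset Nat.Primes} {d m : ℕ}
    (f : (ν : S) → (Fin d → Qv ν) → (Fin m → Qv ν)) (x : QS S d) : QS S (d + m) :=
  fun ν => Fin.append (x ν) (f ν (x ν))

/-- The exponent `ω_τ(M)` of the manifold `M = F(U)`, `U = ∏ U_ν`: the infimum of all `ω` with
`ω_τ(F(x)) ≤ ω` for almost every `x ∈ U`. -/
noncomputable def exponentManifold {S : Finset Nat.Primes} {d m : ℕ} (U : (ν : S) → Set (Fin d → Qv ν))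
    (f : (ν : S) → (Fin d → Qv ν) → (Fin m → Qv ν)) (τ : Fin (d + m) → S → ℝ) : EReal :=
  sInf {w : EReal | ∀ᵐ x ∂(haarQS S d), x ∈ univ.pi U →
    exponentPoint S (d + m) τ (graphMap f x) ≤ w}

/-- `M` is strongly extremal: `ω_τ(M) = 1` for all weights `τ`. -/
def StronglyExtremal {S : Finset Nat.Primes} {d m : ℕ} (U : (ν : S) → Set (Fin d → Qv ν))
    (f : (ν : S) → (Fin d → Qv ν) → (Fin m → Qv ν)) : Prop :=
  ∀ τ : Fin (d + m) → S → ℝ, IsWeight S (d + m) τ → exponentManifold U f τ = 1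

/-! ### Density theorem for products with independently shrinking sides -/

section StrongDensity

open scoped ENNReal

/-! Fix `c > 0` and `N`. The set of `x` for which no integer vector `b` with `‖b‖ ≥ N` approximates
`F(x)` with errors below `c ‖b‖ ^ (-τ)` is shown to be null; countably many such sets, and one
further null set, cover the preimage of `badSet`. The set is porous at almost every of its points:
inside arbitrarily small boxes around `x` it misses sub-boxes of a fixed proportion. As the weights
differ, the side lengths of the boxes are unrelated, so the ordinary density theorem does not
suffice. Its strong form, where all sides shrink independently, follows from the one-dimensional
case by Fubini (`IsDensityBasis.pi`), and gives `haarQS_eq_zero_of_porous`.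

The sub-boxes come from `exists_boxes`. Let `A` be the derivative of `f` at `x`. The weighted
Dirichlet theorem is applied to the forms `b₀ xᵢ - bᵢ`, with a large constant `C`, and to the forms
`b₀ fⱼ(x) - b_{d+j} + A(b - b₀ x)ⱼ`, with a constant `c'` well below `c`; only the product of the
constants matters, so `C` pays for `c'`. Put `z = (bᵢ / b₀)`. The second forms say that the tangent
plane at `x`, evaluated at `z`, is very close to `b_{d+j} / b₀`, hence so is `fⱼ(z)`. The condition
on the weights makes the errors in the independent variables no larger in order than those allowed
for `f`. A box about `z`, smaller by a constant factor, keeps all errors below `c ‖b‖ ^ (-τ)`.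

For `z` to be near `x`, `b₀` must not be too small at any place. This is where strong extremality
enters (`rpow_neg_le_norm_zero`): if `|b₀|_μ < ‖b‖ ^ (-ε)`, integrality of the point makes every
`b_l` equally divisible by `μ`. Dividing out the power of `μ` gives approximations that are too good
for slightly altered weights. -/

/-- A differentiation basis with the density property: almost every point of a measurable set `A`
is a density point of `A` along the sets `I j x` as `j` grows. -/
structure IsDensityBasis {X J : Type*} [MeasurableSpace X] [Preorder J] (μ : Measure X)
    (I : J → X → Set X) : Prop where
  measurable : ∀ j, MeasurableSet {q : X × X | q.2 ∈ I j q.1}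
  density : ∀ A : Set X, MeasurableSet A → ∀ ε : ℝ≥0∞, ε ≠ 0 →
    ∀ᵐ x ∂μ, x ∈ A → ∃ a, ∀ j, a ≤ j → μ (I j x \ A) ≤ ε * μ (I j x)

namespace IsDensityBasis

variable {X Y J J' : Type*} [MeasurableSpace X] [MeasurableSpace Y] [Preorder J] [Preorder J']
  {μ : Measure X} {ν : Measure Y} {I : J → X → Set X} {I' : J' → Y → Set Y}

theorem measurableSet_apply (h : IsDensityBasis μ I) (j : J) (x : X) : MeasurableSet (I j x) :=
  measurable_prodMk_left (x := x) (h.measurable j)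

/-- Transfer of a density basis along a measure preserving equivalence. -/
theorem of_measurePreserving (h : IsDensityBasis ν I') (e : X ≃ᵐ Y) (he : MeasurePreserving e μ ν)
    (φ : J → J') (hφ : ∀ a', ∃ a, ∀ j, a ≤ j → a' ≤ φ j)
    (hI : ∀ j x, I j x = e ⁻¹' I' (φ j) (e x)) : IsDensityBasis μ I where
  measurable j := by
    have := (h.measurable (φ j)).preimage
      ((e.measurable.comp measurable_fst).prodMk (e.measurable.comp measurable_snd))
    simpa [hI] using this
  density A hA ε hε := by
    have hA' : MeasurableSet (e.symm ⁻¹' A) := e.symm.measurable hA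
    have h1 := he.quasiMeasurePreserving.ae (h.density _ hA' ε hε)
    filter_upwards [h1] with x hx hxA
    obtain ⟨a', ha'⟩ := hx (by simpa using hxA)
    obtain ⟨a, ha⟩ := hφ a'
    refine ⟨a, fun j hj => ?_⟩
    have h2 := ha' _ (ha j hj)
    have h3 : I j x \ A = e ⁻¹' (I' (φ j) (e x) \ e.symm ⁻¹' A) := by
      ext y; simp [hI]
    rw [h3, hI, he.measure_preimage_equiv, he.measure_preimage_equiv]
    exact h2

/-- By Fubini, the density property of each slice `{t | (x, t) ∈ A}` suffices, once the good set is
known to be measurable; countability of the scales is needed for that. -/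
theorem density_snd [Countable J'] [SFinite ν] [SFinite μ] (h : IsDensityBasis ν I')
    {A : Set (X × Y)} (hA : MeasurableSet A) {ε : ℝ≥0∞} (hε : ε ≠ 0) :
    ∀ᵐ z ∂μ.prod ν, z ∈ A → ∃ a, ∀ j, a ≤ j →
      ν (I' j z.2 \ {t | (z.1, t) ∈ A}) ≤ ε * ν (I' j z.2) := by
  have hm : ∀ j, MeasurableSet {z : X × Y | ν (I' j z.2 \ {t | (z.1, t) ∈ A}) ≤
      ε * ν (I' j z.2)} := by
    intro j
    have h1 : MeasurableSet {q : (X × Y) × Y | q.2 ∈ I' j q.1.2} :=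
      (h.measurable j).preimage
        ((measurable_snd.comp measurable_fst).prodMk measurable_snd)
    have h2 : MeasurableSet {q : (X × Y) × Y | (q.1.1, q.2) ∈ A} :=
      hA.preimage ((measurable_fst.comp measurable_fst).prodMk measurable_snd)
    exact measurableSet_le (measurable_measure_prodMk_left (h1.diff h2))
      (measurable_const.mul (measurable_measure_prodMk_left h1))
  have hB : MeasurableSet {z : X × Y | z ∈ A → ∃ a, ∀ j, a ≤ j →
      ν (I' j z.2 \ {t | (z.1, t) ∈ A}) ≤ ε * ν (I' j z.2)} := by
    have : {z : X × Y | z ∈ A → ∃ a, ∀ j, a ≤ j →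
      ν (I' j z.2 \ {t | (z.1, t) ∈ A}) ≤ ε * ν (I' j z.2)} = Aᶜ ∪ ⋃ a, ⋂ j, ⋂ (_ : a ≤ j),
        {z : X × Y | ν (I' j z.2 \ {t | (z.1, t) ∈ A}) ≤ ε * ν (I' j z.2)} := by
      ext z; simp [imp_iff_not_or]
    rw [this]
    exact hA.compl.union (MeasurableSet.iUnion fun a => MeasurableSet.iInter fun j =>
      MeasurableSet.iInter fun _ => hm j)
  refine (Measure.ae_prod_mem_iff_ae_ae_mem hB).2 (Filter.Eventually.of_forall fun x => ?_)
  exact h.density {t | (x, t) ∈ A} (measurable_prodMk_left hA) ε hε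

theorem density_fst [Countable J] [SFinite ν] [SFinite μ] (h : IsDensityBasis μ I)
    {A : Set (X × Y)} (hA : MeasurableSet A) {ε : ℝ≥0∞} (hε : ε ≠ 0) :
    ∀ᵐ z ∂μ.prod ν, z ∈ A → ∃ a, ∀ j, a ≤ j →
      μ (I j z.1 \ {s | (s, z.2) ∈ A}) ≤ ε * μ (I j z.1) := by
  have h1 := h.density_snd (μ := ν) (measurable_swap hA) hε
  have h2 : MeasurePreserving Prod.swap (μ.prod ν) (ν.prod μ) := Measure.measurePreserving_swap
  exact h2.quasiMeasurePreserving.ae h1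

/-- The strong density theorem for products of two spaces. -/
theorem prod [Countable J] [Countable J'] [SFinite μ] [SFinite ν]
    (h : IsDensityBasis μ I) (h' : IsDensityBasis ν I') :
    IsDensityBasis (μ.prod ν) (fun (j : J × J') (z : X × Y) => I j.1 z.1 ×ˢ I' j.2 z.2) where
  measurable j := by
    have h1 : MeasurableSet {q : (X × Y) × X × Y | q.2.1 ∈ I j.1 q.1.1} :=
      (h.measurable j.1).preimage
        ((measurable_fst.comp measurable_fst).prodMk (measurable_fst.comp measurable_snd))
    have h2 : MeasurableSet {q : (X × Y) × X × Y | q.2.2 ∈ I' j.2 q.1.2} :=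
      (h'.measurable j.2).preimage
        ((measurable_snd.comp measurable_fst).prodMk (measurable_snd.comp measurable_snd))
    exact h1.inter h2
  density A hA ε hε := by
    have hε2 : ε / 2 ≠ 0 := by simp [hε]
    -- Points of `A` at which the horizontal slice of `A` is dense at all scales beyond `a`.
    -- Uniformity in `a` is what permits a second use of density, vertically and for `K a` in place
    -- of `A`.
    let K : J → Set (X × Y) := fun a => A ∩ ⋂ j, ⋂ (_ : a ≤ j),
      {z : X × Y | μ (I j z.1 \ {s | (s, z.2) ∈ A}) ≤ ε / 2 * μ (I j z.1)}
    have hm : ∀ j, MeasurableSet {z : X × Y | μ (I j z.1 \ {s | (s, z.2) ∈ A}) ≤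
        ε / 2 * μ (I j z.1)} := by
      intro j
      have h1 : MeasurableSet {q : (X × Y) × X | q.2 ∈ I j q.1.1} :=
        (h.measurable j).preimage
          ((measurable_fst.comp measurable_fst).prodMk measurable_snd)
      have h2 : MeasurableSet {q : (X × Y) × X | (q.2, q.1.2) ∈ A} :=
        hA.preimage (measurable_snd.prodMk (measurable_snd.comp measurable_fst))
      exact measurableSet_le (measurable_measure_prodMk_left (h1.diff h2))
        (measurable_const.mul (measurable_measure_prodMk_left h1))
    have hK : ∀ a, MeasurableSet (K a) := fun a => hA.inter
      (MeasurableSet.iInter fun j => MeasurableSet.iInter fun _ => hm j)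
    have key := ae_all_iff.2 fun a => h'.density_snd (μ := μ) (hK a) hε2
    filter_upwards [h.density_fst (ν := ν) hA hε2, key] with z hz1 hz2 hzA
    obtain ⟨a, ha⟩ := hz1 hzA
    have hzK : z ∈ K a := ⟨hzA, by simpa using ha⟩
    obtain ⟨a', ha'⟩ := hz2 a hzK
    refine ⟨(a, a'), fun j hj => ?_⟩
    have hI := h.measurableSet_apply j.1 z.1
    have hI' := h'.measurableSet_apply j.2 z.2
    have hKs : MeasurableSet {t | (z.1, t) ∈ K a} := measurable_prodMk_left (hK a)
    -- Rows at heights `t` with `(z.1, t) ∈ K a` each miss little of `A`; the remaining heights have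
    -- small measure. Each part costs `ε / 2`.
    have hsub : (I j.1 z.1 ×ˢ I' j.2 z.2) \ A ⊆
        ((I j.1 z.1 ×ˢ (I' j.2 z.2 ∩ {t | (z.1, t) ∈ K a})) \ A) ∪
          I j.1 z.1 ×ˢ (I' j.2 z.2 \ {t | (z.1, t) ∈ K a}) := by
      rintro ⟨s, t⟩ ⟨⟨hs, ht⟩, hst⟩
      by_cases hk : (z.1, t) ∈ K a
      · exact Or.inl ⟨⟨hs, ht, hk⟩, hst⟩
      · exact Or.inr ⟨hs, ht, hk⟩
    have hT1 : (μ.prod ν) ((I j.1 z.1 ×ˢ (I' j.2 z.2 ∩ {t | (z.1, t) ∈ K a})) \ A) ≤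
        ε / 2 * (μ (I j.1 z.1) * ν (I' j.2 z.2)) := by
      rw [Measure.prod_apply_symm ((hI.prod (hI'.inter hKs)).diff hA)]
      calc _ ≤ ∫⁻ t, (I' j.2 z.2).indicator (fun _ => ε / 2 * μ (I j.1 z.1)) t ∂ν := by
            refine lintegral_mono fun t => ?_
            by_cases ht : t ∈ I' j.2 z.2 ∧ (z.1, t) ∈ K a
            · rw [indicator_of_mem ht.1]
              have := ht.2.2
              simp only [mem_iInter, mem_ofPred_eq] at this
              refine le_trans (measure_mono ?_) (this j.1 hj.1)
              rintro s ⟨⟨hs, _⟩, hsA⟩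
              exact ⟨hs, hsA⟩
            · have : (fun x => (x, t)) ⁻¹'
                  ((I j.1 z.1 ×ˢ (I' j.2 z.2 ∩ {t | (z.1, t) ∈ K a})) \ A) = ∅ := by
                ext s
                simp only [mem_preimage, mem_sdiff, mem_prod, mem_inter_iff, mem_ofPred_eq,
                  mem_empty_iff_false, iff_false]
                exact fun hs => ht hs.1.2
              rw [this]; simp
        _ = ε / 2 * (μ (I j.1 z.1) * ν (I' j.2 z.2)) := by
            rw [lintegral_indicator hI', setLIntegral_const, mul_assoc]
    have hT2 : (μ.prod ν) (I j.1 z.1 ×ˢ (I' j.2 z.2 \ {t | (z.1, t) ∈ K a})) ≤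
        ε / 2 * (μ (I j.1 z.1) * ν (I' j.2 z.2)) := by
      rw [Measure.prod_prod]
      calc _ ≤ μ (I j.1 z.1) * (ε / 2 * ν (I' j.2 z.2)) := by gcongr; exact ha' _ hj.2
        _ = _ := by ring
    calc _ ≤ _ := (measure_mono hsub).trans (measure_union_le _ _)
      _ ≤ ε / 2 * (μ (I j.1 z.1) * ν (I' j.2 z.2)) + ε / 2 * (μ (I j.1 z.1) * ν (I' j.2 z.2)) :=
          add_le_add hT1 hT2
      _ = ε * (μ.prod ν) (I j.1 z.1 ×ˢ I' j.2 z.2) := by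
          rw [← add_mul, ENNReal.add_halves, Measure.prod_prod]

/-- The strong density theorem for finite products. -/
theorem pi {J : Type} [Preorder J] [Countable J] (ι : Type) [Fintype ι] :
    ∀ (X : ι → Type) [∀ i, MeasurableSpace (X i)] (μ : ∀ i, Measure (X i)) [∀ i, SigmaFinite (μ i)]
      (I : ∀ i, J → X i → Set (X i)), (∀ i, IsDensityBasis (μ i) (I i)) →
      IsDensityBasis (Measure.pi μ)
        (fun (j : ι → J) (x : ∀ i, X i) => univ.pi fun i => I i (j i) (x i)) := by
  refine Fintype.induction_empty_option
    (P := fun ι [Fintype ι] => ∀ (X : ι → Type) [∀ i, MeasurableSpace (X i)]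
      (μ : ∀ i, Measure (X i)) [∀ i, SigmaFinite (μ i)]
      (I : ∀ i, J → X i → Set (X i)), (∀ i, IsDensityBasis (μ i) (I i)) →
      IsDensityBasis (Measure.pi μ)
        (fun (j : ι → J) (x : ∀ i, X i) => univ.pi fun i => I i (j i) (x i))) ?_ ?_ ?_ ι
  · intro α β _ e ih X _ μ _ I hI
    let _ : Fintype α := Fintype.ofEquiv β e.symm
    have h := ih (fun a => X (e a)) (fun a => μ (e a)) (fun a => I (e a)) fun a => hI (e a)
    have hmp := measurePreserving_piCongrLeft μ e
    refine h.of_measurePreserving (MeasurableEquiv.piCongrLeft X e).symm hmp.symm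
      (fun j a => j (e a)) (fun a' => ⟨fun b => a' (e.symm b), fun j hj a => ?_⟩) fun j x => ?_
    · simpa using hj (e a)
    · ext y
      simp only [mem_pi, mem_univ, true_imp_iff, mem_preimage]
      rw [← e.forall_congr_right]
      rfl
  · intro X _ μ _ I hI
    exact
      { measurable := fun j => by simp
        density := fun A hA ε hε => by
          refine Filter.Eventually.of_forall fun x hx => ⟨fun a => a.elim, fun j _ => ?_⟩
          have : A = univ := by
            ext y; simp [Subsingleton.elim y x, hx]
          simp [this] }
  · intro α _ ih X _ μ _ I hI
    have h := (ih (fun a => X (some a)) (fun a => μ (some a)) (fun a => I (some a))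
      fun a => hI (some a)).prod (hI none)
    have hmp : MeasurePreserving (MeasurableEquiv.piOptionEquivProd X) (Measure.pi μ)
        ((Measure.pi fun a => μ (some a)).prod (μ none)) :=
      MeasurePreserving.symm (MeasurableEquiv.piOptionEquivProd X).symm
        ⟨(MeasurableEquiv.piOptionEquivProd X).symm.measurable,
          Measure.pi_map_piOptionEquivProd μ⟩
    refine h.of_measurePreserving _ hmp (fun j => (fun a => j (some a), j none))
      (fun a' => ⟨fun o => o.elim a'.2 a'.1, fun j hj => ⟨fun a => hj (some a), hj none⟩⟩)
      fun j x => ?_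
    ext y
    simp only [mem_pi, mem_univ, true_imp_iff, mem_preimage, mem_prod]
    rw [Option.forall, and_comm]
    rfl

end IsDensityBasis

end StrongDensity

/-! ### Haar measure of boxes, and null sets by porosity -/

section PadicMeasure

open Metric

variable (p : Nat.Primes)

instance isAddHaarMeasure_haarQv : (haarQv p).IsAddHaarMeasure := by
  unfold haarQv; infer_instance

/-- Multiplication by `p` carries Haar measure to a multiple of itself. Only the independence of `C`
from the ball matters: it gives doubling, and compares boxes at scales differing by a fixed `q`. -/
theorem exists_haarQv_closedBall_mul : ∃ C : NNReal, ∀ (x : Qv p) (r : ℝ),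
    haarQv p (closedBall x ((p : ℕ) * r)) = C * haarQv p (closedBall x r) := by
  have hp : ((p : ℕ) : Qv p) ≠ 0 := by exact_mod_cast p.2.ne_zero
  let e : Qv p ≃L[Qv p] Qv p := ContinuousLinearEquiv.unitsEquivAut (Qv p) (Units.mk0 _ hp)
  have hM : ((haarQv p).map e).IsAddHaarMeasure := ContinuousLinearEquiv.isAddHaarMeasure_map e _
  refine ⟨((haarQv p).map e).addHaarScalarFactor (haarQv p), fun x r => ?_⟩
  have h1 := Measure.isAddLeftInvariant_eq_smul ((haarQv p).map e) (haarQv p)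
  have htr : ∀ s, haarQv p (closedBall x s) = haarQv p (closedBall 0 s) := fun s => by
    have := measure_preimage_add (haarQv p) (-x) (closedBall (0 : Qv p) s)
    rw [← this]; congr 1; ext y; simp [dist_eq_norm, neg_add_eq_sub]
  have h2 : e ⁻¹' closedBall 0 r = closedBall 0 ((p : ℕ) * r) := by
    ext y
    have hp0 : (0 : ℝ) < (p : ℕ) := by exact_mod_cast p.2.pos
    simp [e, inv_mul_le_iff₀ hp0, mul_comm]
  rw [htr, htr, ← h2, ← Measure.map_apply e.continuous.measurable isClosed_closedBall.measurableSet]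
  conv_lhs => rw [h1]
  rfl

instance isUnifLocDoublingMeasure_haarQv : IsUnifLocDoublingMeasure (haarQv p) := by
  obtain ⟨C, hC⟩ := exists_haarQv_closedBall_mul p
  refine ⟨⟨C, ?_⟩⟩
  filter_upwards [self_mem_nhdsWithin] with ε hε x
  rw [← hC]
  refine measure_mono (closedBall_subset_closedBall ?_)
  have : (2 : ℝ) ≤ (p : ℕ) := by exact_mod_cast p.2.two_le
  exact mul_le_mul_of_nonneg_right this (le_of_lt hε)

/-- The radius `p⁻ʲ`. -/
noncomputable def padicRadius (j : ℕ) : ℝ := ((p : ℕ) : ℝ)⁻¹ ^ j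

theorem one_lt_prime : (1 : ℝ) < (p : ℕ) := by exact_mod_cast p.2.one_lt

theorem padicRadius_pos (j : ℕ) : 0 < padicRadius p j :=
  pow_pos (inv_pos.2 (zero_lt_one.trans (one_lt_prime p))) _

theorem tendsto_padicRadius : Filter.Tendsto (padicRadius p) Filter.atTop (𝓝 0) :=
  tendsto_pow_atTop_nhds_zero_of_lt_one (inv_nonneg.2 (zero_lt_one.trans (one_lt_prime p)).le)
    (inv_lt_one_of_one_lt₀ (one_lt_prime p))

theorem padicRadius_add (i j : ℕ) : padicRadius p (i + j) = padicRadius p i * padicRadius p j :=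
  pow_add _ _ _

theorem isDensityBasis_haarQv :
    IsDensityBasis (haarQv p) (fun (j : ℕ) (x : Qv p) => closedBall x (padicRadius p j)) where
  measurable j := by
    have : IsClosed {q : Qv p × Qv p | q.2 ∈ closedBall q.1 (padicRadius p j)} := by
      simp only [mem_closedBall]
      exact isClosed_le (by fun_prop) continuous_const
    exact this.measurableSet
  density A hA ε hε := by
    have h := IsUnifLocDoublingMeasure.ae_tendsto_measure_inter_div (haarQv p) A 1
    rw [ae_restrict_iff' hA] at h
    filter_upwards [h] with x hx hxA
    have hlim : Filter.Tendsto (padicRadius p) Filter.atTop (𝓝[>] 0) :=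
      tendsto_nhdsWithin_iff.2 ⟨tendsto_padicRadius p,
        Filter.Eventually.of_forall (padicRadius_pos p)⟩
    have h1 := hx hxA (fun _ => x) (padicRadius p) hlim
      (Filter.Eventually.of_forall fun j => by
        simpa using (padicRadius_pos p j).le)
    have h2 := (ENNReal.tendsto_nhds (by simp)).1 h1 ε (pos_iff_ne_zero.2 hε)
    obtain ⟨a, ha⟩ := Filter.eventually_atTop.1 h2
    refine ⟨a, fun j hj => ?_⟩
    have h3 := (ha j hj).1
    set B := closedBall x (padicRadius p j)
    have hB0 : haarQv p B ≠ 0 := (measure_closedBall_pos _ _ (padicRadius_pos p j)).ne'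
    have hBt : haarQv p B ≠ ⊤ := (isCompact_closedBall x _).measure_lt_top.ne
    have h4 : haarQv p B ≤ haarQv p (A ∩ B) + ε * haarQv p B := by
      have h5 : (1 : ENNReal) ≤ haarQv p (A ∩ B) / haarQv p B + ε :=
        tsub_le_iff_right.1 h3
      calc haarQv p B = 1 * haarQv p B := (one_mul _).symm
        _ ≤ (haarQv p (A ∩ B) / haarQv p B + ε) * haarQv p B := by gcongr
        _ = _ := by rw [add_mul, ENNReal.div_mul_cancel hB0 hBt]
    have h6 : haarQv p (A ∩ B) + haarQv p (B \ A) = haarQv p B := by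
      rw [inter_comm]; exact measure_inter_add_sdiff _ hA
    have hAt : haarQv p (A ∩ B) ≠ ⊤ := ne_top_of_le_ne_top hBt (measure_mono inter_subset_right)
    nth_rewrite 1 [← h6] at h4
    exact (ENNReal.add_le_add_iff_left hAt).1 h4

/-- The density theorem for boxes in `ℚ_S^k`. -/
theorem isDensityBasis_haarQS (S : Finset Nat.Primes) (k : ℕ) :
    IsDensityBasis (haarQS S k) (fun (j : S → Fin k → ℕ) (x : QS S k) =>
      univ.pi fun ν => univ.pi fun i => closedBall (x ν i) (padicRadius ν (j ν i))) :=
  IsDensityBasis.pi S _ _ _ fun ν => IsDensityBasis.pi (Fin k) _ _ _ fun _ =>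
    isDensityBasis_haarQv ν

theorem haarQS_box (S : Finset Nat.Primes) (k : ℕ) (x : QS S k) (r : S → Fin k → ℝ) :
    haarQS S k (univ.pi fun ν => univ.pi fun i => closedBall (x ν i) (r ν i)) =
      ∏ ν : S, ∏ i, haarQv ν (closedBall (x ν i) (r ν i)) := by
  simp only [haarQS, Measure.pi_pi]

/-- A set which, near each of its points, misses a fixed proportion of arbitrarily small boxes is
null. -/
theorem haarQS_eq_zero_of_porous (S : Finset Nat.Primes) (k : ℕ) {B : Set (QS S k)}
    (hB : MeasurableSet B)
    (h : ∀ x ∈ B, ∃ q : ℕ, ∀ N : ℕ, ∃ j : S → Fin k → ℕ, (∀ ν i, N ≤ j ν i) ∧ ∃ z : QS S k,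
      (∀ ν i, z ν i ∈ closedBall (x ν i) (padicRadius ν (j ν i))) ∧
      Disjoint (univ.pi fun ν : S => univ.pi fun i =>
        closedBall (z ν i) (padicRadius ν (j ν i + q))) B) :
    haarQS S k B = 0 := by
  choose C hC using fun ν : S => exists_haarQv_closedBall_mul (ν : Nat.Primes)
  have hCq : ∀ (ν : S) (x : Qv ν) (j q : ℕ), haarQv ν (closedBall x (padicRadius ν j)) =
      (C ν : ENNReal) ^ q * haarQv ν (closedBall x (padicRadius ν (j + q))) := by
    intro ν x j q
    induction q with
    | zero => simp
    | succ q ih =>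
      have hp : ((ν : ℕ) : ℝ) ≠ 0 := by exact_mod_cast ν.1.2.ne_zero
      have h1 : padicRadius ν (j + q) = (ν : ℕ) * padicRadius ν (j + (q + 1)) := by
        rw [padicRadius, padicRadius, ← add_assoc, pow_succ]
        field_simp
      rw [ih, h1, hC, pow_succ, mul_assoc]
  -- The proportion `q` depends on the point, so density is needed for a sequence of tolerances
  -- tending to `0` simultaneously.
  have hae := ae_all_iff.2 fun n : ℕ => (isDensityBasis_haarQS S k).density B hB
    ((n : ENNReal) + 1)⁻¹ (by simp)
  rw [measure_eq_zero_iff_ae_notMem]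
  filter_upwards [hae] with x hx hxB
  obtain ⟨q, hq⟩ := h x hxB
  let D : NNReal := ∏ ν, ∏ _i : Fin k, C ν ^ q
  obtain ⟨n, hn⟩ := exists_nat_gt D
  obtain ⟨a, ha⟩ := hx n hxB
  obtain ⟨j, hj, z, hz, hdisj⟩ := hq (∑ ν, ∑ i, a ν i)
  have haj : a ≤ j := fun ν i => le_trans (le_trans
    (Finset.single_le_sum (f := fun i => a ν i) (fun _ _ => zero_le) (Finset.mem_univ i))
    (Finset.single_le_sum (f := fun ν => ∑ i, a ν i) (fun _ _ => zero_le) (Finset.mem_univ ν)))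
    (hj ν i)
  have h1 := ha j haj
  set R := univ.pi fun ν : S => univ.pi fun i => closedBall (z ν i) (padicRadius ν (j ν i + q))
    with hR
  -- In an ultrametric space any point of a ball is a centre, so the large box may be recentred at
  -- `z` and contains the small one. Their measures differ by the factor `D`, and `D < n`
  -- contradicts density with tolerance `1 / (n + 1)`.
  have hbig : (univ.pi fun ν : S => univ.pi fun i => closedBall (x ν i) (padicRadius ν (j ν i))) =
      univ.pi fun ν : S => univ.pi fun i => closedBall (z ν i) (padicRadius ν (j ν i)) := by
    congr 1; ext1 ν; congr 1; ext1 i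
    exact IsUltrametricDist.closedBall_eq_of_mem (hz ν i)
  have hRsub : R ⊆ (univ.pi fun ν : S => univ.pi fun i =>
      closedBall (x ν i) (padicRadius ν (j ν i))) \ B := by
    rw [hbig]
    refine fun y hy => ⟨fun ν hν i hi => closedBall_subset_closedBall ?_ (hy ν hν i hi),
      fun hyB => hdisj.ne_of_mem hy hyB rfl⟩
    exact pow_le_pow_of_le_one (inv_nonneg.2 (zero_lt_one.trans (one_lt_prime ν)).le)
      (inv_lt_one_of_one_lt₀ (one_lt_prime ν)).le (Nat.le_add_right _ _)
  have h2 : haarQS S k (univ.pi fun ν : S => univ.pi fun i =>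
      closedBall (x ν i) (padicRadius ν (j ν i))) = D * haarQS S k R := by
    rw [hbig, hR, haarQS_box, haarQS_box]
    rw [Finset.prod_congr rfl fun ν _ => Finset.prod_congr rfl fun i _ =>
      hCq ν (z ν i) (j ν i) q]
    simp only [D, Finset.prod_mul_distrib, ENNReal.ofNNReal_finsetProd, ENNReal.coe_pow]
  have hR0 : haarQS S k R ≠ 0 := by
    rw [hR, haarQS_box]
    exact Finset.prod_ne_zero_iff.2 fun ν _ => Finset.prod_ne_zero_iff.2 fun i _ =>
      (measure_closedBall_pos _ _ (padicRadius_pos ν _)).ne'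
  have hRt : haarQS S k R ≠ ⊤ := by
    rw [hR, haarQS_box]
    exact ENNReal.prod_ne_top fun ν _ => ENNReal.prod_ne_top fun i _ =>
      (isCompact_closedBall _ _).measure_lt_top.ne
  have h3 : 1 * haarQS S k R ≤ ((n : ENNReal) + 1)⁻¹ * D * haarQS S k R := by
    rw [one_mul, mul_assoc, ← h2]
    exact (measure_mono hRsub).trans h1
  have h4 := (ENNReal.mul_le_mul_iff_left hR0 hRt).1 h3
  refine absurd h4 (not_le.2 ?_)
  rw [mul_comm, ← div_eq_mul_inv, ENNReal.div_lt_iff (by simp) (by simp)]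
  rw [one_mul]
  calc (D : ENNReal) < (n : ENNReal) := by exact_mod_cast hn
    _ ≤ _ := le_self_add

end PadicMeasure

/-! ### Strict differentiability from continuous difference quotients -/

section StrictDerivative

open Filter Asymptotics

/-- A map with a continuous difference quotient is strictly differentiable. -/
theorem IsC1On.exists_hasStrictFDerivAt {K F ι : Type*} [NontriviallyNormedField K] [Fintype ι]
    [DecidableEq ι] [NormedAddCommGroup F] [NormedSpace K F] {f : (ι → K) → F} {U : Set (ι → K)}
    (hf : IsC1On K f U) (hU : IsOpen U) {x : ι → K} (hx : x ∈ U) :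
    ∃ A : (ι → K) →L[K] F, HasStrictFDerivAt f A x := by
  obtain ⟨g, hgc, hg⟩ := hf
  let e : ι → ι → K := fun i => Pi.single i 1
  -- Telescoping: the coordinates of `p.2` are replaced by those of `p.1` one at a time. Each
  -- replacement is a difference quotient in a basis direction, and continuity of `g` at `(x, e i,
  -- 0)` controls it.
  have key : ∀ s : Finset ι, (fun p : (ι → K) × (ι → K) => f (s.piecewise p.1 p.2) - f p.2 -
      ∑ i ∈ s, (p.1 i - p.2 i) • g (x, e i, 0)) =o[𝓝 (x, x)] fun p => p.1 - p.2 := by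
    intro s
    induction s using Finset.induction_on with
    | empty => simp
    | insert a s ha ih =>
      have hw : ∀ t : Finset ι, Tendsto (fun p : (ι → K) × (ι → K) => t.piecewise p.1 p.2)
          (𝓝 (x, x)) (𝓝 x) := by
        intro t
        rw [tendsto_pi_nhds]
        intro i
        by_cases hi : i ∈ t
        · simp only [Finset.piecewise_eq_of_mem _ _ _ hi]
          exact ((continuous_apply i).comp continuous_fst).tendsto' _ _ rfl
        · simp only [Finset.piecewise_eq_of_notMem _ _ _ hi]
          exact ((continuous_apply i).comp continuous_snd).tendsto' _ _ rfl
      have hstep : ∀ p : (ι → K) × (ι → K), s.piecewise p.1 p.2 + (p.1 a - p.2 a) • e a =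
          (insert a s).piecewise p.1 p.2 := by
        intro p
        rw [Finset.piecewise_insert]
        ext i
        by_cases hi : i = a
        · subst hi
          simp [e, ha]
        · simp [e, hi]
      have hdom : ∀ᶠ p : (ι → K) × (ι → K) in 𝓝 (x, x),
          (s.piecewise p.1 p.2, e a, p.1 a - p.2 a) ∈ diffDomain K U := by
        filter_upwards [hw s (hU.mem_nhds hx), hw (insert a s) (hU.mem_nhds hx)] with p h1 h2
        exact ⟨h1, by simpa only [hstep] using mem_preimage.1 h2⟩
      have hlim : Tendsto (fun p : (ι → K) × (ι → K) =>
          g (s.piecewise p.1 p.2, e a, p.1 a - p.2 a)) (𝓝 (x, x)) (𝓝 (g (x, e a, 0))) := by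
        have hmem : (x, e a, (0 : K)) ∈ diffDomain K U := ⟨hx, by simpa using hx⟩
        refine (hgc _ hmem).tendsto.comp (tendsto_nhdsWithin_iff.2 ⟨?_, hdom⟩)
        refine (hw s).prodMk_nhds (tendsto_const_nhds.prodMk_nhds ?_)
        exact Continuous.tendsto' (by fun_prop) _ _ (by simp)
      have hinc : (fun p : (ι → K) × (ι → K) => (p.1 a - p.2 a) •
          (g (s.piecewise p.1 p.2, e a, p.1 a - p.2 a) - g (x, e a, 0)))
          =o[𝓝 (x, x)] fun p => p.1 - p.2 := by
        have h1 : (fun p : (ι → K) × (ι → K) =>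
            g (s.piecewise p.1 p.2, e a, p.1 a - p.2 a) - g (x, e a, 0)) =o[𝓝 (x, x)]
            fun _ => (1 : ℝ) := (isLittleO_one_iff ℝ).2 (by simpa using hlim.sub_const (g (x, e a, 0)))
        have h2 : (fun p : (ι → K) × (ι → K) => p.1 a - p.2 a) =O[𝓝 (x, x)]
            fun p => ‖p.1 - p.2‖ :=
          IsBigO.of_bound 1 (Eventually.of_forall fun p => by
            simpa using norm_le_pi_norm (p.1 - p.2) a)
        have h3 := h2.smul_isLittleO h1
        simpa using h3
      refine (ih.add hinc).congr' ?_ EventuallyEq.rfl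
      filter_upwards [hdom] with p hp
      have h4 := hg _ hp
      simp only at h4
      rw [hstep] at h4
      rw [smul_sub, h4, Finset.sum_insert ha]
      abel
  refine ⟨∑ i, (ContinuousLinearMap.proj i : (ι → K) →L[K] K).smulRight (g (x, e i, 0)),
    HasStrictFDerivAt.of_isLittleO ?_⟩
  refine (key Finset.univ).congr (fun p => ?_) fun p => rfl
  simp

theorem IsC2On.isC1On {K E F : Type*} [Field K] [TopologicalSpace K]
    [AddCommGroup E] [Module K E] [TopologicalSpace E]
    [AddCommGroup F] [Module K F] [TopologicalSpace F] {f : E → F} {U : Set E}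
    (hf : IsC2On K f U) : IsC1On K f U := by
  obtain ⟨g, hg, -⟩ := hf
  exact ⟨g, hg⟩

end StrictDerivative

/-! ### Weighted Dirichlet theorem over several `p`-adic fields -/

section Dirichlet

open Filter

/-- The pigeonhole principle for systems of linear forms over several `p`-adic fields. -/
theorem exists_small_linear_forms {ι : Type} [Fintype ι] (S : Finset Nat.Primes) (n : ℕ)
    (ξ : (ν : S) → ι → Fin (n + 1) → Qv ν) :
    ∃ M : ℕ, 0 < M ∧ ∀ (k : S → ι → ℕ) (H : ℕ),
      (∏ ν : S, ∏ i, (M * (ν : ℕ) ^ k ν i)) < (H + 1) ^ (n + 1) →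
      ∃ b : Fin (n + 1) → ℤ, b ≠ 0 ∧ ‖b‖ ≤ H ∧
        ∀ (ν : S) (i : ι), ‖∑ l, ξ ν i l * (b l : Qv ν)‖ ≤ padicRadius ν (k ν i) := by
  -- One power `a` makes all coefficients integral. Congruences are then imposed modulo `ν ^ (k +
  -- a)`; the extra factor `ν ^ a` is absorbed in `M`.
  have h1 : ∃ a : ℕ, ∀ (ν : S) i l, ‖((ν : ℕ) : Qv ν) ^ a * ξ ν i l‖ ≤ 1 := by
    have h2 : ∀ᶠ a : ℕ in atTop, ∀ (ν : S) i l, ‖((ν : ℕ) : Qv ν) ^ a * ξ ν i l‖ ≤ 1 := by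
      refine eventually_all.2 fun ν => eventually_all.2 fun i => eventually_all.2 fun l => ?_
      have h3 : Tendsto (fun a => padicRadius ν a * ‖ξ ν i l‖) atTop (𝓝 0) := by
        simpa using (tendsto_padicRadius ν).mul_const ‖ξ ν i l‖
      filter_upwards [h3.eventually_le_const one_pos] with a ha
      simpa [padicRadius] using ha
    exact h2.exists
  obtain ⟨a, ha⟩ := h1
  classical
  let η : (ν : S) → ι → Fin (n + 1) → ℤ_[(ν : ℕ)] := fun ν i l => ⟨_, ha ν i l⟩
  have hMpos : 0 < ∏ ν : S, (ν : ℕ) ^ a :=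
    Finset.prod_pos fun ν _ => pow_pos ν.1.2.pos _
  refine ⟨∏ ν : S, (ν : ℕ) ^ a, hMpos, fun k H hH => ?_⟩
  let Φ : (Fin (n + 1) → Fin (H + 1)) → (ν : S) → (i : ι) → ZMod ((ν : ℕ) ^ (k ν i + a)) :=
    fun b ν i => PadicInt.toZModPow (k ν i + a) (∑ l, η ν i l * ((b l : ℕ) : ℤ_[(ν : ℕ)]))
  have : ∀ (ν : S) i, NeZero ((ν : ℕ) ^ (k ν i + a)) :=
    fun ν i => ⟨pow_ne_zero _ ν.1.2.ne_zero⟩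
  have hcard : Fintype.card ((ν : S) → (i : ι) → ZMod ((ν : ℕ) ^ (k ν i + a))) <
      Fintype.card (Fin (n + 1) → Fin (H + 1)) := by
    simp only [Fintype.card_pi, ZMod.card, Finset.prod_const, Finset.card_univ, Fintype.card_fin]
    refine lt_of_le_of_lt ?_ hH
    refine Finset.prod_le_prod' fun ν _ => Finset.prod_le_prod' fun i _ => ?_
    rw [add_comm, pow_add]
    gcongr
    exact Finset.single_le_prod' (f := fun ν : S => (ν : ℕ) ^ a)
      (fun ν _ => Nat.one_le_pow _ _ ν.1.2.pos) (Finset.mem_univ ν)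
  obtain ⟨u, v, huv, hΦ⟩ := Fintype.exists_ne_map_eq_of_card_lt Φ hcard
  refine ⟨fun l => ((u l : ℕ) : ℤ) - ((v l : ℕ) : ℤ), ?_, ?_, fun ν i => ?_⟩
  · intro h
    refine huv (funext fun l => Fin.ext ?_)
    have := congrFun h l
    simp only [Pi.zero_apply] at this
    omega
  · refine (pi_norm_le_iff_of_nonneg (Nat.cast_nonneg _)).2 fun l => ?_
    rw [Int.norm_eq_abs]
    have h1 := (u l).2
    have h2 := (v l).2
    have h3 : |((u l : ℕ) : ℤ) - ((v l : ℕ) : ℤ)| ≤ (H : ℤ) := by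
      rw [abs_le]; omega
    exact_mod_cast h3
  · have h1 := congrFun (congrFun hΦ ν) i
    simp only [Φ] at h1
    rw [← sub_eq_zero, ← map_sub, ← RingHom.mem_ker, PadicInt.ker_toZModPow,
      ← PadicInt.norm_le_pow_iff_mem_span_pow, ← Finset.sum_sub_distrib (s := Finset.univ) (fun l => η ν i l * ((u l : ℕ) : ℤ_[(ν : ℕ)]))
        (fun l => η ν i l * ((v l : ℕ) : ℤ_[(ν : ℕ)]))] at h1
    have h2 : ((∑ l, (η ν i l * ((u l : ℕ) : ℤ_[(ν : ℕ)]) - η ν i l * ((v l : ℕ) : ℤ_[(ν : ℕ)])) :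
        ℤ_[(ν : ℕ)]) : Qv ν) = ((ν : ℕ) : Qv ν) ^ a *
          ∑ l, ξ ν i l * ((((u l : ℕ) : ℤ) - ((v l : ℕ) : ℤ) : ℤ) : Qv ν) := by
      rw [PadicInt.coe_sum, Finset.mul_sum]
      refine Finset.sum_congr rfl fun l _ => ?_
      have hη : ((η ν i l : ℤ_[(ν : ℕ)]) : Qv ν) = ((ν : ℕ) : Qv ν) ^ a * ξ ν i l := rfl
      rw [PadicInt.coe_sub, PadicInt.coe_mul, PadicInt.coe_mul, hη]
      push_cast
      ring
    rw [PadicInt.norm_def, h2, norm_mul, norm_pow, Padic.norm_p] at h1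
    have hp : (0 : ℝ) < (ν : ℕ) := zero_lt_one.trans (one_lt_prime ν)
    have h3 : (((ν : ℕ) : ℝ)) ^ (-((k ν i + a : ℕ) : ℤ)) = padicRadius ν a * padicRadius ν (k ν i) := by
      rw [zpow_neg, zpow_natCast, mul_comm, ← padicRadius_add, padicRadius, inv_pow]
    rw [h3] at h1
    exact le_of_mul_le_mul_left h1 (padicRadius_pos ν a)

/-- Each target `δ H ^ (-τ)` is rounded down to a power of `ν`, at the cost of a factor at most `ν`.
Since the weights sum to `n + 1`, the number of residue classes is at most `K / ∏ δ` times `H ^ (n +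
1)`, where `K` collects `M` and the rounding losses. -/
theorem exists_weighted_small_linear_forms {ι : Type} [Fintype ι] (S : Finset Nat.Primes) (n : ℕ)
    (ξ : (ν : S) → ι → Fin (n + 1) → Qv ν) (τ : ι → S → ℝ) (hτ : ∀ i ν, 0 < τ i ν)
    (hsum : ∑ i, ∑ ν, τ i ν = n + 1) :
    ∃ K : ℝ, ∀ δ : ι → S → ℝ, (∀ i ν, 0 < δ i ν) → K ≤ ∏ ν, ∏ i, δ i ν →
      ∀ᶠ H : ℕ in atTop, ∃ b : Fin (n + 1) → ℤ, b ≠ 0 ∧ ‖b‖ ≤ H ∧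
        ∀ (ν : S) (i : ι), ‖∑ l, ξ ν i l * (b l : Qv ν)‖ ≤ δ i ν * (H : ℝ) ^ (-τ i ν) := by
  obtain ⟨M, hM, hMk⟩ := exists_small_linear_forms S n ξ
  refine ⟨∏ ν : S, ∏ _i : ι, (M * (ν : ℕ) : ℝ), fun δ hδ hK => ?_⟩
  -- Targets at most `1` are needed for the rounding exponent to be a natural number.
  have hev : ∀ᶠ H : ℕ in atTop, ∀ i ν, δ i ν * (H : ℝ) ^ (-τ i ν) ≤ 1 := by
    refine eventually_all.2 fun i => eventually_all.2 fun ν => ?_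
    have : Tendsto (fun H : ℕ => δ i ν * (H : ℝ) ^ (-τ i ν)) atTop (𝓝 0) := by
      simpa using ((tendsto_rpow_neg_atTop (hτ i ν)).comp tendsto_natCast_atTop_atTop).const_mul
        (δ i ν)
    exact this.eventually_le_const one_pos
  filter_upwards [hev, eventually_ge_atTop 1] with H hH hH1
  have hH0 : (0 : ℝ) < H := by exact_mod_cast hH1
  have hk : ∀ (ν : S) (i : ι), ∃ k : ℕ, padicRadius ν k ≤ δ i ν * (H : ℝ) ^ (-τ i ν) ∧
      ((ν : ℕ) : ℝ) ^ k ≤ (ν : ℕ) * ((δ i ν)⁻¹ * (H : ℝ) ^ τ i ν) := by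
    intro ν i
    have hp : (0 : ℝ) < (ν : ℕ) := zero_lt_one.trans (one_lt_prime ν)
    have hr : 0 < δ i ν * (H : ℝ) ^ (-τ i ν) := mul_pos (hδ i ν) (Real.rpow_pos_of_pos hH0 _)
    obtain ⟨k, hk1, hk2⟩ := exists_nat_pow_near_of_lt_one hr (hH i ν) (inv_pos.2 hp)
      (inv_lt_one_of_one_lt₀ (one_lt_prime ν))
    refine ⟨k + 1, hk1.le, ?_⟩
    rw [pow_succ, mul_comm]
    refine mul_le_mul_of_nonneg_left ?_ hp.le
    have h1 := inv_anti₀ hr hk2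
    rw [inv_pow, inv_inv, mul_inv, Real.rpow_neg hH0.le, inv_inv] at h1
    exact h1
  choose k hk1 hk2 using hk
  obtain ⟨b, hb0, hbH, hb⟩ := hMk k H (by
    have h1 : (∏ ν : S, ∏ i, ((M : ℝ) * (ν : ℕ) ^ k ν i)) ≤ (H : ℝ) ^ (n + 1) := by
      calc (∏ ν : S, ∏ i, ((M : ℝ) * (ν : ℕ) ^ k ν i))
          ≤ ∏ ν : S, ∏ i, (((M : ℝ) * (ν : ℕ)) * ((δ i ν)⁻¹ * (H : ℝ) ^ τ i ν)) := by
            refine Finset.prod_le_prod (fun _ _ => by positivity) fun ν _ =>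
              Finset.prod_le_prod (fun _ _ => by positivity) fun i _ => ?_
            rw [mul_assoc]
            exact mul_le_mul_of_nonneg_left (hk2 ν i) (Nat.cast_nonneg _)
        _ = (∏ ν : S, ∏ _i : ι, (M * (ν : ℕ) : ℝ)) * (∏ ν, ∏ i, δ i ν)⁻¹ *
              (H : ℝ) ^ (∑ ν, ∑ i, τ i ν) := by
            simp only [Finset.prod_mul_distrib, Real.rpow_sum_of_pos hH0, Finset.prod_inv_distrib,
              mul_assoc]
        _ ≤ 1 * (H : ℝ) ^ (∑ ν, ∑ i, τ i ν) := by
            have hP : 0 < ∏ ν, ∏ i, δ i ν :=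
              Finset.prod_pos fun ν _ => Finset.prod_pos fun i _ => hδ i ν
            gcongr
            rw [← div_eq_mul_inv]
            exact (div_le_one hP).2 hK
        _ = (H : ℝ) ^ (n + 1) := by
            rw [Finset.sum_comm, hsum, one_mul, ← Real.rpow_natCast]
            push_cast
            rfl
    have h2 : (H : ℝ) ^ (n + 1) < ((H : ℝ) + 1) ^ (n + 1) := by
      gcongr
      linarith
    exact_mod_cast h1.trans_lt h2)
  exact ⟨b, hb0, hbH, fun ν i => (hb ν i).trans (hk1 ν i)⟩

theorem one_le_norm_of_ne_zero {k : ℕ} {b : Fin k → ℤ} (hb : b ≠ 0) : 1 ≤ ‖b‖ := by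
  obtain ⟨i, hi⟩ := Function.ne_iff.1 hb
  refine le_trans ?_ (norm_le_pi_norm b i)
  rw [Int.norm_eq_abs]
  exact_mod_cast Int.one_le_abs hi

/-- The weighted Dirichlet theorem: the forms have infinitely many small values, unless they have a
common integer zero. -/
theorem exists_large_small_linear_forms {ι : Type} [Fintype ι] (S : Finset Nat.Primes) (n : ℕ)
    (ξ : (ν : S) → ι → Fin (n + 1) → Qv ν) (τ : ι → S → ℝ) (hτ : ∀ i ν, 0 < τ i ν)
    (hsum : ∑ i, ∑ ν, τ i ν = n + 1) :
    ∃ K : ℝ, ∀ δ : ι → S → ℝ, (∀ i ν, 0 < δ i ν) → K ≤ ∏ ν, ∏ i, δ i ν →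
      (∃ b : Fin (n + 1) → ℤ, b ≠ 0 ∧ ∀ (ν : S) (i : ι), ∑ l, ξ ν i l * (b l : Qv ν) = 0) ∨
      ∀ N : ℝ, ∃ b : Fin (n + 1) → ℤ, b ≠ 0 ∧ N ≤ ‖b‖ ∧
        ∀ (ν : S) (i : ι), ‖∑ l, ξ ν i l * (b l : Qv ν)‖ ≤ δ i ν * ‖b‖ ^ (-τ i ν) := by
  obtain ⟨K, hK⟩ := exists_weighted_small_linear_forms S n ξ τ hτ hsum
  refine ⟨K, fun δ hδ hKδ => or_iff_not_imp_left.2 fun hne N => ?_⟩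
  push Not at hne
  have hfin : (Metric.closedBall (0 : Fin (n + 1) → ℤ) N).Finite :=
    (isCompact_closedBall 0 N).finite_of_discrete
  -- Only finitely many `b` have norm at most `N`, and none is a common zero; for large `H` the
  -- bound rules them all out, so the solution found is long.
  have hev : ∀ᶠ H : ℕ in atTop, ∀ b ∈ Metric.closedBall (0 : Fin (n + 1) → ℤ) N, b ≠ 0 →
      ∃ ν i, δ i ν * (H : ℝ) ^ (-τ i ν) < ‖∑ l, ξ ν i l * (b l : Qv ν)‖ := by
    refine (eventually_all_finite hfin).2 fun b _ => ?_
    by_cases hb : b = 0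
    · simp [hb]
    obtain ⟨ν, i, hi⟩ := hne b hb
    have : Tendsto (fun H : ℕ => δ i ν * (H : ℝ) ^ (-τ i ν)) atTop (𝓝 0) := by
      simpa using ((tendsto_rpow_neg_atTop (hτ i ν)).comp tendsto_natCast_atTop_atTop).const_mul
        (δ i ν)
    filter_upwards [this.eventually_lt_const (norm_pos_iff.2 hi)] with H hH _
    exact ⟨ν, i, hH⟩
  obtain ⟨H, ⟨b, hb0, hbH, hb⟩, hH⟩ := ((hK δ hδ hKδ).and hev).exists
  refine ⟨b, hb0, ?_, fun ν i => (hb ν i).trans ?_⟩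
  · by_contra hN
    obtain ⟨ν, i, hi⟩ := hH b (by simpa using (not_le.1 hN).le) hb0
    exact absurd (hb ν i) (not_le.2 hi)
  · refine mul_le_mul_of_nonneg_left ?_ (hδ i ν).le
    exact Real.rpow_le_rpow_of_nonpos (zero_lt_one.trans_le (one_le_norm_of_ne_zero hb0)) hbH
      (neg_nonpos.2 (hτ i ν).le)

end Dirichlet

/-! ### Strong extremality bounds the denominator from below at every place -/

section Extremality

open Filter

variable {S : Finset Nat.Primes} {n : ℕ}

/-- The weights obtained from `τ` by moving `ε` away from the place `μ` and rescaling. -/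
noncomputable def shiftedWeight [DecidableEq S] (τ : Fin n → S → ℝ) (μ : S) (ε : ℝ) :
    Fin n → S → ℝ :=
  fun i ν => (τ i ν - if ν = μ then ε else 0) / (1 - n * ε / (n + 1))

/-- Removing `ε` from each of the `n` weights at `μ` lowers the total by `n ε`, and division by `1 -
n ε / (n + 1)` restores `n + 1`. The condition on each coordinate survives exactly when `ε / (n +
1)` is below its excess over `1`. -/
theorem isWeight_shiftedWeight [DecidableEq S] {τ : Fin n → S → ℝ} (hτ : IsWeight S n τ) (μ : S)
    {ε : ℝ} (h1 : ε < 1) (hετ : ∀ i ν, ε < τ i ν)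
    (hε : ∀ i, ε < (n + 1) * (∑ ν, τ i ν - 1)) : IsWeight S n (shiftedWeight τ μ ε) := by
  have hn : (0 : ℝ) < n + 1 := by positivity
  have hD : 0 < 1 - n * ε / (n + 1) := by
    rw [sub_pos, div_lt_one hn]
    have : (0 : ℝ) ≤ n := Nat.cast_nonneg n
    nlinarith
  refine ⟨fun i ν => div_pos ?_ hD, ?_, fun i => ?_⟩
  · split_ifs
    · linarith [hετ i ν]
    · linarith [hτ.pos i ν]
  · simp only [shiftedWeight, ← Finset.sum_div, Finset.sum_sub_distrib, hτ.sum_eq,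
      Finset.sum_ite_eq', Finset.mem_univ, if_true, Finset.sum_const, Finset.card_univ,
      Fintype.card_fin, nsmul_eq_mul]
    rw [div_eq_iff hD.ne']
    field_simp
  · simp only [shiftedWeight, ← Finset.sum_div, Finset.sum_sub_distrib,
      Finset.sum_ite_eq', Finset.mem_univ, if_true]
    rw [lt_div_iff₀ hD, one_mul]
    have := hε i
    have h2 : n * ε / (n + 1) = ε - ε / (n + 1) := by field_simp; ring
    have h3 : ε / (n + 1) < ∑ ν, τ i ν - 1 := by rwa [div_lt_iff₀' hn]
    linarith

theorem exists_lt_of_exponentPoint_le {τ : Fin n → S → ℝ} {y : QS S n} {w ω : ℝ}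
    (h : exponentPoint S n τ y ≤ w) (hω : w < ω) :
    ∃ N : ℝ, ∀ b : Fin (n + 1) → ℤ, N ≤ ‖b‖ → ∃ (i : Fin n) (ν : S),
      ‖b‖ ^ (-ω) < ‖(b 0 : Qv ν) * y ν i + (b i.succ : Qv ν)‖ ^ (1 / τ i ν) := by
  have hfin : {b : Fin (n + 1) → ℤ | ∀ (i : Fin n) (ν : S),
      ‖(b 0 : Qv ν) * y ν i + (b i.succ : Qv ν)‖ ^ (1 / τ i ν) ≤ ‖b‖ ^ (-ω)}.Finite := by
    by_contra hinf
    have h1 : (ω : EReal) ≤ exponentPoint S n τ y := le_sSup ⟨ω, rfl, hinf⟩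
    exact absurd (EReal.coe_le_coe_iff.1 (h1.trans h)) (not_le.2 hω)
  obtain ⟨R, hR⟩ := (hfin.image fun b => ‖b‖).bddAbove
  refine ⟨R + 1, fun b hb => ?_⟩
  by_contra hcon
  push Not at hcon
  have := hR (mem_image_of_mem _ (show b ∈ _ from hcon))
  linarith

theorem ae_exponentPoint_le {d m : ℕ} {U : (ν : S) → Set (Fin d → Qv ν)}
    {f : (ν : S) → (Fin d → Qv ν) → (Fin m → Qv ν)} (hM : StronglyExtremal U f)
    {τ : Fin (d + m) → S → ℝ} (hτ : IsWeight S (d + m) τ) {w : ℝ} (hw : 1 < w) :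
    ∀ᵐ x ∂haarQS S d, x ∈ univ.pi U → exponentPoint S (d + m) τ (graphMap f x) ≤ w := by
  have h1 : exponentManifold U f τ < w := by
    rw [hM τ hτ]; exact_mod_cast hw
  obtain ⟨v, hv, hvw⟩ := sInf_lt_iff.1 h1
  filter_upwards [hv] with x hx hxU
  exact (hx hxU).trans hvw.le

theorem norm_coe_prime_pow_of_ne {p q : Nat.Primes} (h : p ≠ q) (k : ℕ) :
    ‖(((q : ℕ) : Qv p)) ^ k‖ = 1 := by
  have hpq : (p : ℕ).Coprime q := (Nat.coprime_primes p.2 q.2).2 fun h' => h (Subtype.ext h')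
  have : ‖((q : ℕ) : Qv p)‖ = 1 := by
    rw [Padic.norm_natCast_eq_one_iff]
    exact hpq
  rw [norm_pow, this, one_pow]

/-- Good approximations with a denominator divisible by a high power of a prime would, after
division, be too good. -/
theorem rpow_neg_le_norm_zero [DecidableEq S] {τ : Fin n → S → ℝ} (hτ : IsWeight S n τ) (μ : S)
    {ε : ℝ} (hε0 : 0 < ε) (h1 : ε < 1) (hετ : ∀ i ν, ε < τ i ν) {y : QS S n}
    (hy : ∀ ν : S, y ν ∈ integralPoints ν n) {w : ℝ} (hw1 : 0 < w)
    (hw : w < (1 - n * ε / (n + 1)) / (1 - ε))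
    (hexp : exponentPoint S n (shiftedWeight τ μ ε) y ≤ w) (C : ℝ) :
    ∃ N : ℝ, ∀ b : Fin (n + 1) → ℤ, N ≤ ‖b‖ →
      (∀ (i : Fin n) (ν : S), ‖(b 0 : Qv ν) * y ν i - (b i.succ : Qv ν)‖ ≤ C * ‖b‖ ^ (-τ i ν)) →
      ‖b‖ ^ (-ε) ≤ ‖(b 0 : Qv μ)‖ := by
  set D : ℝ := 1 - n * ε / (n + 1) with hD
  obtain ⟨ω, hwω, hωs⟩ := exists_between hw
  have hω0 : 0 < ω := hw1.trans hwω
  have hε1 : 0 < 1 - ε := by linarith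
  have hD0 : 0 < D := by
    by_contra hcon
    have : D / (1 - ε) ≤ 0 := div_nonpos_of_nonpos_of_nonneg (not_lt.1 hcon) hε1.le
    linarith
  obtain ⟨N0, hN0⟩ := exists_lt_of_exponentPoint_le hexp hwω
  let σ : Fin n → S → ℝ := fun i ν => τ i ν - if ν = μ then ε else 0
  have hσ0 : ∀ i ν, 0 < σ i ν := by
    intro i ν
    simp only [σ]
    split_ifs
    · linarith [hετ i ν]
    · linarith [hτ.pos i ν]
  have hσD : ∀ i ν, shiftedWeight τ μ ε i ν = σ i ν / D := fun i ν => rfl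
  -- The surplus that yields the contradiction. After division the vector has size about `h ^ (1 -
  -- ε)`, so the exponent bound forces some error above a constant times `h ^ (-(1 - ε) * ω * σ /
  -- D)`, while all errors are at most `C * h ^ (-σ)`.
  have hθ : 0 < 1 - (1 - ε) * ω / D := by
    rw [sub_pos, div_lt_one hD0, mul_comm]
    exact (lt_div_iff₀ hε1).1 hωs
  have hp1 := one_lt_prime μ
  have hp0 : (0 : ℝ) < (μ : ℕ) := zero_lt_one.trans hp1
  have ev1 : ∀ᶠ h : ℝ in atTop, N0 ≤ h ^ (1 - ε) := (tendsto_rpow_atTop hε1).eventually_ge_atTop N0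
  have ev2 : ∀ᶠ h : ℝ in atTop, ∀ i : Fin n, C ≤ h ^ (τ i μ - ε) :=
    eventually_all.2 fun i =>
      (tendsto_rpow_atTop (sub_pos.2 (hετ i μ))).eventually_ge_atTop C
  have ev3 : ∀ᶠ h : ℝ in atTop, ∀ (i : Fin n) (ν : S),
      C * ((μ : ℕ) : ℝ) ^ (ω * (σ i ν / D)) ≤ h ^ (σ i ν * (1 - (1 - ε) * ω / D)) :=
    eventually_all.2 fun i => eventually_all.2 fun ν =>
      (tendsto_rpow_atTop (mul_pos (hσ0 i ν) hθ)).eventually_ge_atTop _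
  obtain ⟨N, hN⟩ := eventually_atTop.1 (ev1.and (ev2.and (ev3.and (eventually_ge_atTop 1))))
  refine ⟨N, fun b hb herr => ?_⟩
  obtain ⟨hh1, hh2, hh3, hh4⟩ := hN _ hb
  set h := ‖b‖
  have hpos : 0 < h := zero_lt_one.trans_le hh4
  by_contra hcon
  rw [not_le] at hcon
  -- The power of `μ` to divide out: `μ ^ k ≤ h ^ ε < μ ^ (k + 1)`.
  obtain ⟨k, hk1, hk2⟩ := exists_nat_pow_near (Real.one_le_rpow hh4 hε0.le) hp1
  -- Since `y` is integral, `b₀ y_i` is as small as `b₀`, and `b_i` differs from it by an error that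
  -- is smaller still.
  have hall : ∀ l, ‖(b l : Qv μ)‖ ≤ h ^ (-ε) := by
    refine Fin.cases hcon.le fun i => ?_
    have h2 : (b i.succ : Qv μ) = (b 0 : Qv μ) * y μ i - ((b 0 : Qv μ) * y μ i - b i.succ) := by
      ring
    rw [h2]
    rw [sub_eq_add_neg]
    refine (IsUltrametricDist.norm_add_le_max _ _).trans (max_le ?_ ((norm_neg _).le.trans <| (herr i μ).trans ?_))
    · rw [norm_mul]
      exact (mul_le_of_le_one_right (norm_nonneg _) (hy μ i)).trans hcon.le
    · calc C * h ^ (-τ i μ) ≤ h ^ (τ i μ - ε) * h ^ (-τ i μ) := by gcongr; exact hh2 i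
        _ = h ^ (-ε) := by rw [← Real.rpow_add hpos]; ring_nf
  have hdvd : ∀ l, ((μ : ℕ) ^ k : ℤ) ∣ b l := by
    intro l
    have h3 : ‖(b l : Qv μ)‖ ≤ ((μ : ℕ) : ℝ) ^ (-(k : ℤ)) := by
      refine (hall l).trans ?_
      rw [Real.rpow_neg hpos.le, zpow_neg, zpow_natCast]
      exact inv_anti₀ (pow_pos hp0 k) hk1
    exact_mod_cast (Padic.norm_int_le_pow_iff_dvd (b l) k).1 h3
  choose b' hb' using hdvd
  -- The exponent is defined with `b₀ y + b_i`, the approximation with `b₀ y - b_i`; hence the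
  -- change of sign.
  let b'' : Fin (n + 1) → ℤ := Fin.cons (b' 0) fun i => -b' i.succ
  have hnorm'' : ‖b''‖ = ‖b'‖ := by
    refine le_antisymm ((pi_norm_le_iff_of_nonneg (norm_nonneg _)).2 (Fin.cases ?_ fun i => ?_))
      ((pi_norm_le_iff_of_nonneg (norm_nonneg _)).2 (Fin.cases ?_ fun i => ?_))
    · exact norm_le_pi_norm b' 0
    · simpa [b''] using norm_le_pi_norm b' i.succ
    · simpa [b''] using norm_le_pi_norm b'' 0
    · simpa [b''] using norm_le_pi_norm b'' i.succ
  have hbb' : h = ((μ : ℕ) : ℝ) ^ k * ‖b'‖ := by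
    have h4 : b = ((μ : ℕ) ^ k : ℤ) • b' := by
      ext l; simp [hb' l]
    have h5 : h = ‖((μ : ℕ) ^ k : ℤ) • b'‖ := congrArg norm h4
    rw [h5, norm_smul, Int.norm_eq_abs]
    push_cast
    rw [abs_of_pos (pow_pos hp0 k)]
  have hb'eq : ‖b'‖ = h / ((μ : ℕ) : ℝ) ^ k := by
    rw [hbb']; field_simp
  have hlow : h ^ (1 - ε) ≤ ‖b'‖ := by
    rw [hb'eq, Real.rpow_sub hpos, Real.rpow_one]
    gcongr
  have hup : ‖b'‖ ≤ (μ : ℕ) * h ^ (1 - ε) := by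
    rw [hb'eq, div_le_iff₀ (pow_pos hp0 k), Real.rpow_sub hpos, Real.rpow_one]
    have h6 : h ^ ε ≤ (μ : ℕ) * ((μ : ℕ) : ℝ) ^ k := by
      rw [← pow_succ']; exact hk2.le
    have h7 : 0 < h ^ ε := Real.rpow_pos_of_pos hpos _
    calc h = h / h ^ ε * h ^ ε := by field_simp
      _ ≤ h / h ^ ε * ((μ : ℕ) * ((μ : ℕ) : ℝ) ^ k) := by gcongr
      _ = _ := by ring
  have hb'0 : 0 < ‖b'‖ := (Real.rpow_pos_of_pos hpos _).trans_le hlow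
  obtain ⟨i, ν, hiν⟩ := hN0 b'' (by rw [hnorm'']; exact hh1.trans hlow)
  -- Division by `μ ^ k` enlarges the error at `μ` by at most `h ^ ε` and leaves the other places
  -- unchanged, which is the shift from `τ` to `σ`.
  have herr' : ‖(b'' 0 : Qv ν) * y ν i + (b'' i.succ : Qv ν)‖ ≤ C * h ^ (-σ i ν) := by
    have h8 : (b 0 : Qv ν) * y ν i - (b i.succ : Qv ν) = ((μ : ℕ) : Qv ν) ^ k *
        ((b'' 0 : Qv ν) * y ν i + (b'' i.succ : Qv ν)) := by
      rw [hb' 0, hb' i.succ]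
      simp only [b'', Fin.cons_zero, Fin.cons_succ]
      push_cast
      ring
    have h9 := herr i ν
    rw [h8, norm_mul] at h9
    by_cases hνμ : ν = μ
    · subst hνμ
      rw [norm_pow, Padic.norm_p, inv_pow, inv_mul_le_iff₀ (pow_pos hp0 k)] at h9
      have hC : 0 ≤ C * h ^ (-τ i ν) := (norm_nonneg _).trans (herr i ν)
      refine h9.trans ((mul_le_mul_of_nonneg_right hk1 hC).trans_eq ?_)
      simp only [σ, if_true]
      rw [mul_left_comm, ← Real.rpow_add hpos]
      ring_nf
    · rw [norm_coe_prime_pow_of_ne (fun h' => hνμ (Subtype.ext h')), one_mul] at h9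
      simpa [σ, hνμ] using h9
  rw [hnorm'', hσD] at hiν
  have hτ'' : 0 < σ i ν / D := div_pos (hσ0 i ν) hD0
  have h10 : (‖b'‖ ^ (-ω)) ^ (σ i ν / D) < C * h ^ (-σ i ν) := by
    have h11 := Real.rpow_lt_rpow (Real.rpow_nonneg hb'0.le _) hiν hτ''
    rw [← Real.rpow_mul (norm_nonneg ((b'' 0 : Qv ν) * y ν i + (b'' i.succ : Qv ν))),
      one_div_mul_cancel hτ''.ne', Real.rpow_one] at h11
    exact h11.trans_le herr'
  have h12 : ((μ : ℕ) * h ^ (1 - ε)) ^ (-(ω * (σ i ν / D))) < C * h ^ (-σ i ν) := by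
    refine lt_of_le_of_lt ?_ h10
    rw [← Real.rpow_mul hb'0.le, neg_mul]
    exact Real.rpow_le_rpow_of_nonpos hb'0 hup (neg_nonpos.2 (mul_pos hω0 hτ'').le)
  rw [Real.mul_rpow hp0.le (Real.rpow_nonneg hpos.le _), ← Real.rpow_mul hpos.le,
    Real.rpow_neg hp0.le, inv_mul_lt_iff₀ (Real.rpow_pos_of_pos hp0 _)] at h12
  have h13 := mul_le_mul_of_nonneg_right (hh3 i ν) (Real.rpow_nonneg hpos.le (-σ i ν))
  rw [← Real.rpow_add hpos] at h13
  have h14 : σ i ν * (1 - (1 - ε) * ω / D) + -σ i ν = (1 - ε) * -(ω * (σ i ν / D)) := by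
    field_simp; ring
  rw [h14] at h13
  linarith

/-- On a strongly extremal manifold, almost no point has infinitely many good approximations whose
denominator is divisible by a high power of some prime of `S`. -/
theorem ae_rpow_neg_le_norm_zero {d m : ℕ} {U : (ν : S) → Set (Fin d → Qv ν)}
    {f : (ν : S) → (Fin d → Qv ν) → (Fin m → Qv ν)} (hM : StronglyExtremal U f)
    (hint : ∀ x ∈ univ.pi U, ∀ ν : S, graphMap f x ν ∈ integralPoints ν (d + m))
    {τ : Fin (d + m) → S → ℝ} (hτ : IsWeight S (d + m) τ) :
    ∃ ε : ℝ, (∀ i ν, ε < τ i ν) ∧ ∀ᵐ x ∂haarQS S d, x ∈ univ.pi U → ∀ C : ℝ,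
      ∃ N : ℝ, ∀ b : Fin (d + m + 1) → ℤ, N ≤ ‖b‖ →
        (∀ (i : Fin (d + m)) (ν : S),
          ‖(b 0 : Qv ν) * graphMap f x ν i - (b i.succ : Qv ν)‖ ≤ C * ‖b‖ ^ (-τ i ν)) →
        ∀ ν : S, ‖b‖ ^ (-ε) ≤ ‖(b 0 : Qv ν)‖ := by
  classical
  have hn0 : (0 : ℝ) < ((d + m : ℕ) : ℝ) + 1 := by positivity
  have hlt : ∀ c : ℝ, 0 < c → ∀ᶠ ε in 𝓝[>] (0 : ℝ), ε < c := fun c hc =>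
    nhdsWithin_le_nhds (eventually_lt_nhds hc)
  have hex : ∀ᶠ ε in 𝓝[>] (0 : ℝ), 0 < ε ∧ ε < 1 ∧ (∀ i ν, ε < τ i ν) ∧
      ∀ i, ε < ((d + m : ℕ) + 1) * (∑ ν, τ i ν - 1) :=
    (show ∀ᶠ ε in 𝓝[>] (0 : ℝ), 0 < ε from self_mem_nhdsWithin).and ((hlt 1 one_pos).and
      ((eventually_all.2 fun i => eventually_all.2 fun ν => hlt _ (hτ.pos i ν)).and
        (eventually_all.2 fun i => hlt _ (mul_pos hn0 (sub_pos.2 (hτ.one_lt i))))))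
  obtain ⟨ε, hε0, hε1, hετ, hεs⟩ := hex.exists
  -- The numerator loses less than `ε`, so the exponent reached after division exceeds `1`, the
  -- value allowed by extremality.
  have hs : 1 < (1 - (d + m : ℕ) * ε / ((d + m : ℕ) + 1)) / (1 - ε) := by
    rw [lt_div_iff₀ (by linarith), one_mul, sub_lt_sub_iff_left, div_lt_iff₀ hn0]
    nlinarith
  obtain ⟨w, hw1, hw⟩ := exists_between hs
  refine ⟨ε, hετ, ?_⟩
  have hae := ae_all_iff.2 fun μ : S =>
    ae_exponentPoint_le hM (isWeight_shiftedWeight hτ μ hε1 hετ hεs) hw1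
  filter_upwards [hae] with x hx hxU C
  choose N hN using fun μ : S => rpow_neg_le_norm_zero hτ μ hε0 hε1 hετ (hint x hxU)
    (zero_lt_one.trans hw1) hw (hx μ hxU) C
  obtain ⟨R, hR⟩ := (finite_range N).bddAbove
  exact ⟨R, fun b hb herr μ => hN μ b ((hR (mem_range_self μ)).trans hb) herr⟩

end Extremality

/-! ### Boxes of well approximable points on the manifold -/

section Manifold

open Filter Metric

variable {S : Finset Nat.Primes} {d m : ℕ}

/-- The linear forms `b₀ xᵢ - bᵢ` and `b₀ yⱼ - b_{d+j} + A(b - b₀ x)ⱼ` in `b`. -/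
noncomputable def approxForm {K : Type*} [Field K] (x : Fin d → K) (y : Fin m → K)
    (A : (Fin d → K) →ₗ[K] (Fin m → K)) : Fin (d + m) → (Fin (d + m + 1) → K) →ₗ[K] K :=
  Fin.addCases
    (fun i => x i • LinearMap.proj 0 - LinearMap.proj (Fin.castAdd m i).succ)
    (fun j => y j • LinearMap.proj 0 - LinearMap.proj (Fin.natAdd d j).succ +
      LinearMap.proj j ∘ₗ A ∘ₗ
        LinearMap.pi fun i => LinearMap.proj (Fin.castAdd m i).succ - x i • LinearMap.proj 0)

theorem approxForm_castAdd {K : Type*} [Field K] (x : Fin d → K) (y : Fin m → K)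
    (A : (Fin d → K) →ₗ[K] (Fin m → K)) (i : Fin d) (b : Fin (d + m + 1) → K) :
    approxForm x y A (Fin.castAdd m i) b = b 0 * x i - b (Fin.castAdd m i).succ := by
  simp [approxForm, mul_comm]

theorem approxForm_natAdd {K : Type*} [Field K] (x : Fin d → K) (y : Fin m → K)
    (A : (Fin d → K) →ₗ[K] (Fin m → K)) (j : Fin m) (b : Fin (d + m + 1) → K) :
    approxForm x y A (Fin.natAdd d j) b = b 0 * y j - b (Fin.natAdd d j).succ +
      A (fun i => b (Fin.castAdd m i).succ - b 0 * x i) j := by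
  simp only [approxForm, Fin.addCases_right, LinearMap.add_apply, LinearMap.sub_apply,
    LinearMap.smul_apply, LinearMap.proj_apply, smul_eq_mul, LinearMap.comp_apply]
  rw [mul_comm]
  refine congrArg (fun v => b 0 * y j - b (Fin.natAdd d j).succ + A v j) (funext fun i => ?_)
  simp [mul_comm]

theorem sum_coeff_approxForm {K : Type*} [Field K] {k : ℕ} (φ : (Fin k → K) →ₗ[K] K)
    (b : Fin k → K) : ∑ l, φ (fun i => if l = i then 1 else 0) * b l = φ b := by
  rw [LinearMap.pi_apply_eq_sum_univ φ b]
  exact Finset.sum_congr rfl fun l _ => mul_comm _ _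

/-- The error at `x'` splits into the variation of `f` from `z` to `x'`, the Taylor remainder from
`x` to `z`, and the value of the tangent form; the three bounds add up. -/
theorem norm_approx_le {p : Nat.Primes} {f : (Fin d → Qv p) → (Fin m → Qv p)}
    {A : (Fin d → Qv p) →L[Qv p] (Fin m → Qv p)} {x z x' : Fin d → Qv p} {β v : Qv p} {j : Fin m}
    {L η T T' E : ℝ} (hL : 0 ≤ L) (hη : 0 ≤ η) (hz : ‖β • (z - x)‖ ≤ T) (hx' : ‖β • (x' - z)‖ ≤ T')
    (hlip : ‖f x' - f z‖ ≤ L * ‖x' - z‖) (hdiff : ‖f z - f x - A (z - x)‖ ≤ η * ‖z - x‖)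
    (hform : ‖β * f x j - v + A (β • (z - x)) j‖ ≤ E) :
    ‖β * f x' j - v‖ ≤ L * T' + η * T + E := by
  have h1 : ‖β * (f x' j - f z j)‖ ≤ L * T' := by
    rw [norm_mul]
    rw [norm_smul] at hx'
    calc ‖β‖ * ‖f x' j - f z j‖ ≤ ‖β‖ * (L * ‖x' - z‖) := by
          gcongr
          exact (norm_le_pi_norm (f x' - f z) j).trans hlip
      _ = L * (‖β‖ * ‖x' - z‖) := by ring
      _ ≤ L * T' := by gcongr
  have h2 : ‖β * (f z j - f x j - A (z - x) j)‖ ≤ η * T := by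
    rw [norm_mul]
    rw [norm_smul] at hz
    calc ‖β‖ * ‖f z j - f x j - A (z - x) j‖ ≤ ‖β‖ * (η * ‖z - x‖) := by
          gcongr
          exact (norm_le_pi_norm (f z - f x - A (z - x)) j).trans hdiff
      _ = η * (‖β‖ * ‖z - x‖) := by ring
      _ ≤ η * T := by gcongr
  have h3 : β * f x' j - v = β * (f x' j - f z j) + β * (f z j - f x j - A (z - x) j) +
      (β * f x j - v + A (β • (z - x)) j) := by
    rw [map_smul, Pi.smul_apply, smul_eq_mul]
    ring
  rw [h3]
  exact (norm_add₃_le).trans (add_le_add (add_le_add h1 h2) hform)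

/-- Strict differentiability gives a Lipschitz bound between arbitrary points near `x`, as needed
for `z` and `x'`. The constant `L` serves all places and does not depend on `η`; only the radius
does. -/
theorem exists_lipschitz_nhds {U : (ν : S) → Set (Fin d → Qv ν)} (hU : ∀ ν, IsOpen (U ν))
    {f : (ν : S) → (Fin d → Qv ν) → (Fin m → Qv ν)} {x : QS S d} (hx : ∀ ν, x ν ∈ U ν)
    {A : (ν : S) → (Fin d → Qv ν) →L[Qv ν] (Fin m → Qv ν)}
    (hA : ∀ ν, HasStrictFDerivAt (f ν) (A ν) (x ν)) :
    ∃ L : ℝ, 0 < L ∧ ∀ η : ℝ, 0 < η → ∃ r : ℝ, 0 < r ∧ ∀ ν, closedBall (x ν) r ⊆ U ν ∧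
      (∀ u ∈ closedBall (x ν) r, ∀ v ∈ closedBall (x ν) r, ‖f ν u - f ν v‖ ≤ L * ‖u - v‖) ∧
      ∀ u ∈ closedBall (x ν) r, ‖f ν u - f ν (x ν) - A ν (u - x ν)‖ ≤ η * ‖u - x ν‖ := by
  choose L s hs hL using fun ν => (hA ν).exists_lipschitzOnWith
  refine ⟨∑ ν, (L ν : ℝ) + 1, by positivity, fun η hη => ?_⟩
  have hev : ∀ᶠ r in 𝓝[>] (0 : ℝ), ∀ ν, closedBall (x ν) r ⊆ U ν ∧
      (∀ u ∈ closedBall (x ν) r, ∀ v ∈ closedBall (x ν) r,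
        ‖f ν u - f ν v‖ ≤ (∑ ν, (L ν : ℝ) + 1) * ‖u - v‖) ∧
      ∀ u ∈ closedBall (x ν) r, ‖f ν u - f ν (x ν) - A ν (u - x ν)‖ ≤ η * ‖u - x ν‖ := by
    refine eventually_all.2 fun ν => nhdsWithin_le_nhds ?_
    have h1 : ∀ᶠ u in 𝓝 (x ν), ‖f ν u - f ν (x ν) - A ν (u - x ν)‖ ≤ η * ‖u - x ν‖ :=
      (hA ν).hasFDerivAt.isLittleO.def hη
    filter_upwards [eventually_closedBall_subset ((hU ν).mem_nhds (hx ν)),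
      eventually_closedBall_subset (hs ν), eventually_closedBall_subset h1] with r hr1 hr2 hr3
    refine ⟨hr1, fun u hu v hv => ?_, fun u hu => hr3 hu⟩
    refine ((hL ν).norm_sub_le (hr2 hu) (hr2 hv)).trans ?_
    gcongr
    have := Finset.single_le_sum (f := fun ν => (L ν : ℝ)) (fun _ _ => NNReal.coe_nonneg _)
      (Finset.mem_univ ν)
    linarith
  obtain ⟨r, h0, hr⟩ := ((show ∀ᶠ r in 𝓝[>] (0 : ℝ), 0 < r from self_mem_nhdsWithin).and hev).exists
  exact ⟨r, h0, hr⟩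

/-- The source of porosity: around the rational point `z` with coordinates `bᵢ / b₀`, a whole box
consists of points well approximated by the same `b`. That `q` precedes `N` and `R` makes the
proportion uniform in the scale. The first alternative is a rational point, where Dirichlet's
theorem need not supply long vectors. -/
theorem exists_boxes (hd : 1 ≤ d) {U : (ν : S) → Set (Fin d → Qv ν)}
    (hU : ∀ ν, IsOpen (U ν)) {f : (ν : S) → (Fin d → Qv ν) → (Fin m → Qv ν)}
    {τ : Fin (d + m) → S → ℝ} (hτ : IsWeight S (d + m) τ)
    (hdom : ∀ (ν : S) (i : Fin d) (j : Fin m), τ (Fin.natAdd d j) ν ≤ τ (Fin.castAdd m i) ν)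
    {x : QS S d} (hx : ∀ ν, x ν ∈ U ν) {A : (ν : S) → (Fin d → Qv ν) →L[Qv ν] (Fin m → Qv ν)}
    (hA : ∀ ν, HasStrictFDerivAt (f ν) (A ν) (x ν)) {ε : ℝ} (hε : ∀ i ν, ε < τ i ν)
    (hext : ∀ C : ℝ, ∃ N : ℝ, ∀ b : Fin (d + m + 1) → ℤ, N ≤ ‖b‖ →
      (∀ (i : Fin (d + m)) (ν : S),
        ‖(b 0 : Qv ν) * graphMap f x ν i - (b i.succ : Qv ν)‖ ≤ C * ‖b‖ ^ (-τ i ν)) →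
      ∀ ν : S, ‖b‖ ^ (-ε) ≤ ‖(b 0 : Qv ν)‖) {c : ℝ} (hc : 0 < c) :
    (∃ b : Fin (d + m + 1) → ℤ, b ≠ 0 ∧ ∀ (i : Fin (d + m)) (ν : S),
      (b 0 : Qv ν) * graphMap f x ν i - (b i.succ : Qv ν) = 0) ∨
    ∃ q : ℕ, ∀ (N : ℕ) (R : ℝ), ∃ j : S → Fin d → ℕ, (∀ ν i, N ≤ j ν i) ∧ ∃ z : QS S d,
      (∀ ν i, z ν i ∈ closedBall (x ν i) (padicRadius ν (j ν i))) ∧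
      ∃ b : Fin (d + m + 1) → ℤ, R ≤ ‖b‖ ∧ ∀ x' ∈ univ.pi fun ν : S => univ.pi fun i =>
        closedBall (z ν i) (padicRadius ν (j ν i + q)), (∀ ν, x' ν ∈ U ν) ∧
        ∀ (i : Fin (d + m)) (ν : S),
          ‖(b 0 : Qv ν) * graphMap f x' ν i - (b i.succ : Qv ν)‖ < c * ‖b‖ ^ (-τ i ν) := by
  let φ : (ν : S) → Fin (d + m) → (Fin (d + m + 1) → Qv ν) →ₗ[Qv ν] Qv ν :=
    fun ν => approxForm (x ν) (f ν (x ν)) (A ν : (Fin d → Qv ν) →ₗ[Qv ν] (Fin m → Qv ν))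
  obtain ⟨K, hK⟩ := exists_large_small_linear_forms S (d + m)
    (fun ν i l => φ ν i fun k => if l = k then 1 else 0) τ hτ.pos (by simpa using hτ.sum_eq)
  simp only [sum_coeff_approxForm] at hK
  have hS : Nonempty S := by
    by_contra hne
    rw [not_nonempty_iff] at hne
    have := hτ.sum_eq
    simp only [Finset.univ_eq_empty, Finset.sum_empty, Finset.sum_const_zero] at this
    have : (0 : ℝ) < (d + m : ℕ) + 1 := by positivity
    linarith
  -- Three error terms of size at most `c'` arise for `f`; a quarter leaves the final inequality
  -- strict.
  set c' := c / 4 with hc'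
  have hc'0 : 0 < c' := by positivity
  -- Since `d ≥ 1` and `S` is nonempty, the product of constants grows without bound in `C`, so a
  -- large `C` compensates for the small `c'`.
  obtain ⟨C, hC0, hCK⟩ : ∃ C : ℝ, 0 < C ∧
      K ≤ ∏ ν : S, ∏ i, Fin.addCases (motive := fun _ => ℝ) (fun _ : Fin d => C)
        (fun _ : Fin m => c') i := by
    have h1 : Tendsto (fun C : ℝ => (C ^ d * c' ^ m) ^ Fintype.card S) atTop atTop :=
      (tendsto_pow_atTop Fintype.card_ne_zero).comp
        ((tendsto_pow_atTop (by omega)).atTop_mul_const (pow_pos hc'0 m))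
    obtain ⟨C, h2, h3⟩ := ((h1.eventually_ge_atTop K).and (eventually_gt_atTop 0)).exists
    refine ⟨C, h3, h2.trans_eq ?_⟩
    simp [Fin.prod_univ_add]
  have hD := hK (fun i _ => Fin.addCases (motive := fun _ => ℝ) (fun _ : Fin d => C)
    (fun _ : Fin m => c') i) (fun i _ => by
      refine Fin.addCases (fun i => ?_) (fun i => ?_) i <;> simpa) hCK
  rcases hD with ⟨b, hb0, hb⟩ | hD
  · refine Or.inl ⟨b, hb0, fun i ν => ?_⟩
    have h1 : ∀ i : Fin d, (b 0 : Qv ν) * x ν i - b (Fin.castAdd m i).succ = 0 := fun i => by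
      have := hb ν (Fin.castAdd m i)
      simpa only [φ, approxForm_castAdd] using this
    refine Fin.addCases (fun i => ?_) (fun j => ?_) i
    · simpa [graphMap] using h1 i
    · have h2 := hb ν (Fin.natAdd d j)
      simp only [φ, approxForm_natAdd] at h2
      have h3 : (fun i => (b (Fin.castAdd m i).succ : Qv ν) - b 0 * x ν i) = 0 := by
        ext i
        rw [Pi.zero_apply, ← neg_sub, h1, neg_zero]
      rw [h3, map_zero, Pi.zero_apply, add_zero] at h2
      simpa [graphMap] using h2
  right
  obtain ⟨L, hL0, hL⟩ := exists_lipschitz_nhds hU hx hA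
  obtain ⟨r, hr0, hr⟩ := hL (c' / C) (by positivity)
  -- The constant covers both kinds of error at `x`: `C` for the coordinates, and for `f` the
  -- tangent form plus the removed term `A(b - b₀ x)`.
  obtain ⟨N1, hN1⟩ := hext (C + (c' + (∑ ν, ‖A ν‖) * C))
  -- The shrinking factor: the factor `ν` is lost in rounding the radius to a power of `ν`, and `L +
  -- 1` makes the bound serve both the coordinates and, after the Lipschitz estimate, `f`.
  have hq : ∃ q : ℕ, ∀ ν : S, (ν : ℕ) * C * padicRadius ν q ≤ c' / (L + 1) := by
    have h1 : ∀ᶠ q in atTop, ∀ ν : S, (ν : ℕ) * C * padicRadius ν q ≤ c' / (L + 1) := by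
      refine eventually_all.2 fun ν => ?_
      have h2 : Tendsto (fun q => (ν : ℕ) * C * padicRadius ν q) atTop (𝓝 0) := by
        simpa using (tendsto_padicRadius ν).const_mul (((ν : ℕ) : ℝ) * C)
      exact h2.eventually_le_const (by positivity)
    exact h1.exists
  obtain ⟨q, hq⟩ := hq
  refine ⟨q, fun N R => ?_⟩
  -- With `|b₀|_ν ≥ h ^ (-ε)` the distance from `x` to `z` is at most `C * h ^ (-(τ - ε))`, which
  -- tends to `0` because `ε < τ`.
  have hsmall : ∀ᶠ h : ℝ in atTop, ∀ (i : Fin d) (ν : S),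
      (ν : ℕ) * (C * h ^ (-(τ (Fin.castAdd m i) ν - ε))) ≤ min r (padicRadius ν N) := by
    refine eventually_all.2 fun i => eventually_all.2 fun ν => ?_
    have h1 : Tendsto (fun h : ℝ => (ν : ℕ) * (C * h ^ (-(τ (Fin.castAdd m i) ν - ε)))) atTop
        (𝓝 0) := by
      simpa using ((tendsto_rpow_neg_atTop (sub_pos.2 (hε (Fin.castAdd m i) ν))).const_mul
        C).const_mul ((ν : ℕ) : ℝ)
    exact h1.eventually_le_const (lt_min hr0 (padicRadius_pos ν N))
  obtain ⟨N2, hN2⟩ := eventually_atTop.1 hsmall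
  obtain ⟨b, hb0, hbN, hb⟩ := hD (max R (max N1 N2))
  set h := ‖b‖ with hh
  have hh1 : 1 ≤ h := one_le_norm_of_ne_zero hb0
  have hhpos : 0 < h := zero_lt_one.trans_le hh1
  have hmono : ∀ (ν : S) (i : Fin d) (j : Fin m),
      h ^ (-τ (Fin.castAdd m i) ν) ≤ h ^ (-τ (Fin.natAdd d j) ν) := fun ν i j =>
    Real.rpow_le_rpow_of_exponent_le hh1 (neg_le_neg (hdom ν i j))
  have herrx : ∀ (ν : S) (i : Fin d), ‖(b 0 : Qv ν) * x ν i - b (Fin.castAdd m i).succ‖ ≤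
      C * h ^ (-τ (Fin.castAdd m i) ν) := fun ν i => by
    simpa only [φ, approxForm_castAdd, Fin.addCases_left] using hb ν (Fin.castAdd m i)
  have herrf : ∀ (ν : S) (j : Fin m), ‖(b 0 : Qv ν) * f ν (x ν) j - b (Fin.natAdd d j).succ +
      A ν (fun i => (b (Fin.castAdd m i).succ : Qv ν) - b 0 * x ν i) j‖ ≤
      c' * h ^ (-τ (Fin.natAdd d j) ν) := fun ν j => by
    have h1 := hb ν (Fin.natAdd d j)
    simp only [φ, approxForm_natAdd, Fin.addCases_right] at h1
    exact h1
  have hvec : ∀ (ν : S) (j : Fin m),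
      ‖fun i => (b (Fin.castAdd m i).succ : Qv ν) - b 0 * x ν i‖ ≤
        C * h ^ (-τ (Fin.natAdd d j) ν) := fun ν j => by
    refine (pi_norm_le_iff_of_nonneg (by positivity)).2 fun i => ?_
    rw [norm_sub_rev]
    exact (herrx ν i).trans (mul_le_mul_of_nonneg_left (hmono ν i j) hC0.le)
  have hAnn : 0 ≤ ∑ ν, ‖A ν‖ := Finset.sum_nonneg fun _ _ => norm_nonneg _
  have hb0low : ∀ ν : S, h ^ (-ε) ≤ ‖(b 0 : Qv ν)‖ := by
    refine hN1 b ((le_max_left _ _).trans ((le_max_right _ _).trans hbN)) fun i ν => ?_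
    refine Fin.addCases (fun i => ?_) (fun j => ?_) i
    · simp only [graphMap, Fin.append_left]
      refine (herrx ν i).trans ?_
      gcongr
      have : 0 ≤ c' + (∑ ν, ‖A ν‖) * C := by positivity
      linarith
    · simp only [graphMap, Fin.append_right]
      have h1 : ‖A ν (fun i => (b (Fin.castAdd m i).succ : Qv ν) - b 0 * x ν i) j‖ ≤
          (∑ ν, ‖A ν‖) * C * h ^ (-τ (Fin.natAdd d j) ν) := by
        refine (norm_le_pi_norm (A ν _) j).trans (((A ν).le_opNorm _).trans ?_)
        rw [mul_assoc]
        exact mul_le_mul (Finset.single_le_sum (f := fun ν => ‖A ν‖) (fun _ _ => norm_nonneg _)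
          (Finset.mem_univ ν)) (hvec ν j) (norm_nonneg _) hAnn
      have h2 := herrf ν j
      have h3 := norm_sub_le ((b 0 : Qv ν) * f ν (x ν) j - b (Fin.natAdd d j).succ +
        A ν (fun i => (b (Fin.castAdd m i).succ : Qv ν) - b 0 * x ν i) j)
        (A ν (fun i => (b (Fin.castAdd m i).succ : Qv ν) - b 0 * x ν i) j)
      rw [add_sub_cancel_right] at h3
      have h4 : 0 ≤ C * h ^ (-τ (Fin.natAdd d j) ν) := by positivity
      rw [add_mul, add_mul]
      linarith
  have hβpos : ∀ ν : S, 0 < ‖(b 0 : Qv ν)‖ := fun ν =>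
    (Real.rpow_pos_of_pos hhpos _).trans_le (hb0low ν)
  have hβ0 : ∀ ν : S, (b 0 : Qv ν) ≠ 0 := fun ν => norm_pos_iff.1 (hβpos ν)
  let ρ : S → Fin d → ℝ := fun ν i => C * h ^ (-τ (Fin.castAdd m i) ν) / ‖(b 0 : Qv ν)‖
  have hρ0 : ∀ (ν : S) i, 0 < ρ ν i := fun ν i => div_pos (by positivity) (hβpos ν)
  have hρle : ∀ (ν : S) i, ν.1 * ρ ν i ≤ min r (padicRadius ν N) := fun ν i => by
    refine le_trans ?_ (hN2 h ((le_max_right _ _).trans ((le_max_right _ _).trans hbN)) i ν)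
    refine mul_le_mul_of_nonneg_left ?_ (Nat.cast_nonneg _)
    rw [div_le_iff₀ (hβpos ν), mul_assoc]
    refine mul_le_mul_of_nonneg_left ?_ hC0.le
    calc h ^ (-τ (Fin.castAdd m i) ν)
        = h ^ (-(τ (Fin.castAdd m i) ν - ε)) * h ^ (-ε) := by
          rw [← Real.rpow_add hhpos]; ring_nf
      _ ≤ _ := by gcongr; exact hb0low ν
  have hp1 : ∀ ν : S, (1 : ℝ) < (ν : ℕ) := fun ν => one_lt_prime ν
  have hρN : ∀ (ν : S) i, ρ ν i ≤ padicRadius ν N := fun ν i =>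
    (le_mul_of_one_le_left (hρ0 ν i).le (hp1 ν).le).trans ((hρle ν i).trans (min_le_right _ _))
  have hinv0 : ∀ ν : S, 0 < (((ν : ℕ) : ℝ))⁻¹ := fun ν => inv_pos.2 (zero_lt_one.trans (hp1 ν))
  have hinv1 : ∀ ν : S, (((ν : ℕ) : ℝ))⁻¹ < 1 := fun ν => inv_lt_one_of_one_lt₀ (hp1 ν)
  have hj : ∀ (ν : S) i, ∃ j : ℕ, padicRadius ν (j + 1) < ρ ν i ∧ ρ ν i ≤ padicRadius ν j := fun ν i =>
    exists_nat_pow_near_of_lt_one (hρ0 ν i)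
      ((hρN ν i).trans (pow_le_one₀ (hinv0 ν).le (hinv1 ν).le)) (hinv0 ν) (hinv1 ν)
  choose j hj1 hj2 using hj
  have hjr : ∀ (ν : S) i, padicRadius ν (j ν i) ≤ ν.1 * ρ ν i := fun ν i => by
    have h1 := (hj1 ν i).le
    rw [padicRadius, pow_succ', inv_mul_le_iff₀ (zero_lt_one.trans (hp1 ν))] at h1
    exact h1
  have hzx : ∀ (ν : S) i, (b (Fin.castAdd m i).succ : Qv ν) / b 0 ∈
      closedBall (x ν i) (padicRadius ν (j ν i)) := fun ν i => by
    refine le_trans ?_ (hj2 ν i)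
    have h1 : (b (Fin.castAdd m i).succ : Qv ν) / b 0 - x ν i =
        -((b 0 : Qv ν) * x ν i - b (Fin.castAdd m i).succ) / b 0 := by
      have := hβ0 ν
      field_simp
      ring
    rw [dist_eq_norm, h1, norm_div, norm_neg]
    exact div_le_div_of_nonneg_right (herrx ν i) (norm_nonneg _)
  refine ⟨j, fun ν i => ?_, fun ν i => (b (Fin.castAdd m i).succ : Qv ν) / b 0, hzx, b,
    (le_max_left _ _).trans hbN, fun x' hx' => ?_⟩
  · by_contra hlt
    have h1 : padicRadius ν N ≤ padicRadius ν (j ν i + 1) :=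
      pow_le_pow_of_le_one (hinv0 ν).le (hinv1 ν).le (by omega)
    linarith [hj1 ν i, hρN ν i]
  · set z : QS S d := fun ν i => (b (Fin.castAdd m i).succ : Qv ν) / b 0 with hzdef
    have hβz : ∀ (ν : S) i, (b 0 : Qv ν) * z ν i = b (Fin.castAdd m i).succ := fun ν i =>
      mul_div_cancel₀ _ (hβ0 ν)
    have hx'z : ∀ (ν : S) i, ‖(b 0 : Qv ν) * (x' ν i - z ν i)‖ ≤
        c' / (L + 1) * h ^ (-τ (Fin.castAdd m i) ν) := fun ν i => by
      have h1 : ‖x' ν i - z ν i‖ ≤ padicRadius ν (j ν i) * padicRadius ν q := by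
        rw [← padicRadius_add, ← dist_eq_norm]
        exact hx' ν (mem_univ ν) i (mem_univ i)
      have hρβ : ‖(b 0 : Qv ν)‖ * ρ ν i = C * h ^ (-τ (Fin.castAdd m i) ν) :=
        mul_div_cancel₀ _ (hβpos ν).ne'
      rw [norm_mul]
      calc ‖(b 0 : Qv ν)‖ * ‖x' ν i - z ν i‖
          ≤ ‖(b 0 : Qv ν)‖ * ((ν.1 * ρ ν i) * padicRadius ν q) := by
            gcongr
            exact h1.trans (mul_le_mul_of_nonneg_right (hjr ν i) (padicRadius_pos ν q).le)
        _ = (ν : ℕ) * (‖(b 0 : Qv ν)‖ * ρ ν i) * padicRadius ν q := by ring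
        _ = (ν : ℕ) * C * padicRadius ν q * h ^ (-τ (Fin.castAdd m i) ν) := by rw [hρβ]; ring
        _ ≤ _ := mul_le_mul_of_nonneg_right (hq ν) (by positivity)
    have hzr : ∀ ν : S, z ν ∈ closedBall (x ν) r := fun ν => by
      refine (dist_pi_le_iff hr0.le).2 fun i => ?_
      exact (hzx ν i).trans ((hjr ν i).trans ((hρle ν i).trans (min_le_left _ _)))
    have hx'r : ∀ ν : S, x' ν ∈ closedBall (x ν) r := fun ν => by
      refine (dist_pi_le_iff hr0.le).2 fun i => ?_
      have h1 : x' ν i ∈ closedBall (z ν i) (padicRadius ν (j ν i)) :=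
        closedBall_subset_closedBall (pow_le_pow_of_le_one (hinv0 ν).le (hinv1 ν).le
          (Nat.le_add_right _ _)) (hx' ν (mem_univ ν) i (mem_univ i))
      rw [← IsUltrametricDist.closedBall_eq_of_mem (hzx ν i)] at h1
      exact (mem_closedBall.1 h1).trans ((hjr ν i).trans ((hρle ν i).trans (min_le_left _ _)))
    have hL1 : c' / (L + 1) ≤ c' := div_le_self hc'0.le (by linarith)
    refine ⟨fun ν => (hr ν).1 (hx'r ν), fun i ν => ?_⟩
    refine Fin.addCases (fun i => ?_) (fun j => ?_) i
    · simp only [graphMap, Fin.append_left]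
      rw [← hβz, ← mul_sub]
      have hpow : 0 < h ^ (-τ (Fin.castAdd m i) ν) := Real.rpow_pos_of_pos hhpos _
      refine (hx'z ν i).trans_lt (mul_lt_mul_of_pos_right ?_ hpow)
      linarith
    · simp only [graphMap, Fin.append_right]
      have hpow : 0 < h ^ (-τ (Fin.natAdd d j) ν) := Real.rpow_pos_of_pos hhpos _
      have hvz : (fun i => (b (Fin.castAdd m i).succ : Qv ν) - b 0 * x ν i) =
          (b 0 : Qv ν) • (z ν - x ν) := by
        funext i
        rw [Pi.smul_apply, Pi.sub_apply, smul_eq_mul, mul_sub, hβz]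
      have h1 : ‖(b 0 : Qv ν) • (z ν - x ν)‖ ≤ C * h ^ (-τ (Fin.natAdd d j) ν) := by
        rw [← hvz]; exact hvec ν j
      have h2 : ‖(b 0 : Qv ν) • (x' ν - z ν)‖ ≤ c' / (L + 1) * h ^ (-τ (Fin.natAdd d j) ν) := by
        refine (pi_norm_le_iff_of_nonneg (by positivity)).2 fun i => ?_
        exact (hx'z ν i).trans (mul_le_mul_of_nonneg_left (hmono ν i j) (by positivity))
      have h3 := herrf ν j
      rw [hvz] at h3
      refine (norm_approx_le hL0.le (by positivity) h1 h2 ((hr ν).2.1 _ (hx'r ν) _ (hzr ν))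
        ((hr ν).2.2 _ (hzr ν)) h3).trans_lt ?_
      have h4 : L * (c' / (L + 1)) ≤ c' := by
        rw [mul_div_assoc', div_le_iff₀ (by linarith)]
        nlinarith
      have h5 : c' / C * C = c' := div_mul_cancel₀ _ hC0.ne'
      calc _ = (L * (c' / (L + 1)) + c' / C * C + c') * h ^ (-τ (Fin.natAdd d j) ν) := by ring
        _ < c * h ^ (-τ (Fin.natAdd d j) ν) := mul_lt_mul_of_pos_right (by linarith) hpow

theorem isOpen_setOf_approx {U : (ν : S) → Set (Fin d → Qv ν)} (hU : ∀ ν, IsOpen (U ν))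
    {f : (ν : S) → (Fin d → Qv ν) → (Fin m → Qv ν)} (hf : ∀ ν, ContinuousOn (f ν) (U ν))
    (b : Fin (d + m + 1) → ℤ) (e : Fin (d + m) → S → ℝ) :
    IsOpen (univ.pi U ∩ {x | ∀ (i : Fin (d + m)) (ν : S),
      ‖(b 0 : Qv ν) * graphMap f x ν i - (b i.succ : Qv ν)‖ < e i ν}) := by
  have hc : ContinuousOn (graphMap f) (univ.pi U) := by
    refine continuousOn_pi.2 fun ν => continuousOn_pi.2 fun i => ?_
    refine Fin.addCases (fun i => ?_) (fun j => ?_) i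
    · simp only [graphMap, Fin.append_left]
      fun_prop
    · simp only [graphMap, Fin.append_right]
      exact (continuous_apply j).comp_continuousOn
        ((hf ν).comp (continuous_apply ν).continuousOn fun x hx => hx ν (mem_univ ν))
  have ho : IsOpen {y : QS S (d + m) | ∀ (i : Fin (d + m)) (ν : S),
      ‖(b 0 : Qv ν) * y ν i - (b i.succ : Qv ν)‖ < e i ν} := by
    simp only [ofPred_forall]
    exact isOpen_iInter_of_finite fun i => isOpen_iInter_of_finite fun ν =>
      isOpen_lt (by fun_prop) continuous_const
  exact hc.isOpen_inter_preimage (isOpen_set_pi finite_univ fun ν _ => hU ν) ho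

end Manifold

theorem corollary8p9 (S : Finset Nat.Primes) (d m : ℕ) (hd : 1 ≤ d)
    (U : (ν : S) → Set (Fin d → Qv ν))
    (hU : ∀ ν, IsOpen (U ν)) (hUint : ∀ ν : S, U ν ⊆ integralPoints ν d)
    (f : (ν : S) → (Fin d → Qv ν) → (Fin m → Qv ν))
    (hfint : ∀ ν : S, MapsTo (f ν) (U ν) (integralPoints ν m))
    (hf : ∀ ν : S, IsC2On (Qv ν) (f ν) (U ν))
    (τ : Fin (d + m) → S → ℝ) (hτ : IsWeight S (d + m) τ)
    (hdom : ∀ (ν : S) (i : Fin d) (j : Fin m), τ (Fin.natAdd d j) ν ≤ τ (Fin.castAdd m i) ν)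
    (hM : StronglyExtremal U f) :
    haarQS S d (univ.pi U ∩ graphMap f ⁻¹' badSet S (d + m) τ) = 0 := by
  have hint : ∀ x ∈ univ.pi U, ∀ ν : S, graphMap f x ν ∈ integralPoints ν (d + m) := by
    intro x hx ν
    refine Fin.addCases (fun i => ?_) (fun j => ?_)
    · simpa [graphMap] using hUint ν (hx ν (mem_univ ν)) i
    · simpa [graphMap] using hfint ν (hx ν (mem_univ ν)) j
  choose! A hA using fun (ν : S) (x : Fin d → Qv ν) (hx : x ∈ U ν) =>
    (hf ν).isC1On.exists_hasStrictFDerivAt (hU ν) hx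
  have hcont : ∀ ν, ContinuousOn (f ν) (U ν) := fun ν x hx =>
    (hA ν x hx).hasFDerivAt.continuousAt.continuousWithinAt
  obtain ⟨ε, hετ, hae⟩ := ae_rpow_neg_le_norm_zero hM hint hτ
  let G : QS S d → Prop := fun x => x ∈ univ.pi U → ∀ C : ℝ,
      ∃ N : ℝ, ∀ b : Fin (d + m + 1) → ℤ, N ≤ ‖b‖ →
        (∀ (i : Fin (d + m)) (ν : S),
          ‖(b 0 : Qv ν) * graphMap f x ν i - (b i.succ : Qv ν)‖ ≤ C * ‖b‖ ^ (-τ i ν)) →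
        ∀ ν : S, ‖b‖ ^ (-ε) ≤ ‖(b 0 : Qv ν)‖
  let O : ℝ → (Fin (d + m + 1) → ℤ) → Set (QS S d) := fun c b =>
    univ.pi U ∩ {x | ∀ (i : Fin (d + m)) (ν : S),
      ‖(b 0 : Qv ν) * graphMap f x ν i - (b i.succ : Qv ν)‖ < c * ‖b‖ ^ (-τ i ν)}
  have hO : ∀ c b, IsOpen (O c b) := fun c b => isOpen_setOf_approx hU hcont b _
  -- A measurable null cover of the exceptional points, so that the sets `B` below are measurable.
  let T : Set (QS S d) := (toMeasurable (haarQS S d) {x | ¬ G x})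
  have hT : haarQS S d T = 0 := by rw [measure_toMeasurable]; exact hae
  let B : ℕ → ℕ → Set (QS S d) := fun ℓ N =>
    (univ.pi U \ ⋃ b : Fin (d + m + 1) → ℤ, ⋃ (_ : (N : ℝ) ≤ ‖b‖), O (1 / ((ℓ : ℝ) + 1)) b) \ T
  have hB : ∀ ℓ N, haarQS S d (B ℓ N) = 0 := by
    intro ℓ N
    have hc : (0 : ℝ) < 1 / ((ℓ : ℝ) + 1) := by positivity
    refine haarQS_eq_zero_of_porous S d ?_ fun x hx => ?_
    · refine (((isOpen_set_pi finite_univ fun ν _ => hU ν).measurableSet).diff ?_).diff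
        (measurableSet_toMeasurable _ _)
      exact (isOpen_iUnion fun b => isOpen_iUnion fun _ => hO _ b).measurableSet
    obtain ⟨⟨hxU, hxO⟩, hxT⟩ := hx
    have hGx : G x := by
      by_contra hcon
      exact hxT (subset_toMeasurable _ _ hcon)
    have hnot : ∀ x' ∈ univ.pi U, ∀ b : Fin (d + m + 1) → ℤ, (N : ℝ) ≤ ‖b‖ →
        (∀ (i : Fin (d + m)) (ν : S), ‖(b 0 : Qv ν) * graphMap f x' ν i - (b i.succ : Qv ν)‖ <
          1 / ((ℓ : ℝ) + 1) * ‖b‖ ^ (-τ i ν)) → x' ∉ B ℓ N := by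
      intro x' hx' b hb herr hx'B
      exact hx'B.1.2 (mem_iUnion₂.2 ⟨b, hb, hx', herr⟩)
    rcases exists_boxes hd hU hτ hdom (fun ν => hxU ν (mem_univ ν))
      (fun ν => hA ν (x ν) (hxU ν (mem_univ ν))) hετ (hGx hxU) hc with ⟨b, hb0, hb⟩ | ⟨q, hq⟩
    -- At a rational point every multiple of `b` has zero error, and the multiple by `N + 1` is long
    -- enough to exclude `x` from `B ℓ N`.
    · exfalso
      have hb1 := one_le_norm_of_ne_zero hb0
      have hnorm : ‖((N : ℤ) + 1) • b‖ = ((N : ℝ) + 1) * ‖b‖ := by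
        rw [norm_smul, Int.norm_eq_abs]
        push_cast
        rw [abs_of_pos (by positivity)]
      have hpos : 0 < ‖((N : ℤ) + 1) • b‖ := by rw [hnorm]; positivity
      refine hnot x hxU (((N : ℤ) + 1) • b) ?_ (fun i ν => ?_) ⟨⟨hxU, hxO⟩, hxT⟩
      · rw [hnorm]
        nlinarith
      · have h1 : ((((N : ℤ) + 1) • b) 0 : Qv ν) * graphMap f x ν i -
            ((((N : ℤ) + 1) • b) i.succ : Qv ν) = 0 := by
          simp only [Pi.smul_apply, smul_eq_mul]
          push_cast
          rw [mul_assoc, ← mul_sub, hb i ν, mul_zero]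
        rw [h1, norm_zero]
        exact mul_pos hc (Real.rpow_pos_of_pos hpos _)
    · refine ⟨q, fun M => ?_⟩
      obtain ⟨j, hj, z, hz, b, hb, hbox⟩ := hq M N
      refine ⟨j, hj, z, hz, disjoint_left.2 fun x' hx' => ?_⟩
      obtain ⟨h1, h2⟩ := hbox x' hx'
      exact hnot x' (fun ν _ => h1 ν) b hb h2
  refine measure_mono_null ?_ (measure_union_null hT
    (measure_iUnion_null fun ℓ => measure_iUnion_null fun N => hB ℓ N))
  rintro x ⟨hxU, -, hx⟩
  by_cases hxT : x ∈ T
  · exact Or.inl hxT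
  rw [mem_iInter, not_forall] at hx
  obtain ⟨ℓ, hℓ⟩ := hx
  have hfin : {b : Fin (d + m + 1) → ℤ | ∀ (i : Fin (d + m)) (ν : S),
      ‖(b 0 : Qv ν) * graphMap f x ν i - (b i.succ : Qv ν)‖ <
        1 / ((ℓ : ℝ) + 1) * ‖b‖ ^ (-τ i ν)}.Finite := by
    by_contra hinf
    exact hℓ ⟨hint x hxU, hinf⟩
  obtain ⟨R, hR⟩ := (hfin.image fun b => ‖b‖).bddAbove
  obtain ⟨N, hN⟩ := exists_nat_gt R
  refine Or.inr (mem_iUnion₂.2 ⟨ℓ, N, ⟨hxU, fun hxO => ?_⟩, hxT⟩)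
  obtain ⟨b, hb, -, hxb⟩ := mem_iUnion₂.1 hxO
  have := hR (mem_image_of_mem _ hxb)
  linarith
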